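/- **Proposition 2.11.** Consider unoriented 2-tangles in a 3-ball (with end points NW, SW, NE, SE), up to isotopy fixing the boundary. A *$\pm5$-move* replaces two parallel strands by five half-twists of one and the same sign, and two tangles are *5-move equivalent* if they are related by finitely many isotopies, $\pm 5$-moves and inverses of such moves. For coprime integers $p,q$ let $[\frac pq]=[\frac{-p}{-q}]$ be the rational tangle with fraction $\frac pq$ in Conway's notation: $[0]$ consists of two horizontal strands, $[\frac10]$ of two vertical ones, $[a+x]$ is obtained from $[x]$ by adding the row $[a]$ of $|a|$ horizontal half-twists (of sign that of $a\in\mathbb Z$) on the right, and $[\frac1x]$ is the mirror image of $[x]$ rotated by a quarter turn. Every rational tangle $[\frac pq]$ lies in exactly one of the 5-move equivalence classes of the twelve tangles $[\frac10],[0],[-1],[1],[-2],[2],[\frac25],[\frac52],[\frac32],[-\frac32],[\frac12],[-\frac12]$. Namely, $[\frac pq]$ lies in the class of * $[\frac10]$ if and only if $q\equiv0$ and $p\equiv\pm1 \pmod 5$; * $[\frac25]$ if and only if $q\equiv0$ and $p\equiv\pm2 \pmod 5$; * $[0]$ if and only if $q\equiv\pm1$ and $p\equiv0 \pmod 5$;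 * $[\frac52]$ if and only if $q\equiv\pm2$ and $p\equiv0 \pmod 5$; * $[-1]$ if and only if $q\equiv\pm1$ and $p\equiv-q \pmod 5$; * $[\frac32]$ if and only if $q\equiv\pm2$ and $p\equiv-q \pmod 5$; * $[1]$ if and only if $q\equiv\pm1$ and $p\equiv q \pmod 5$; * $[-\frac32]$ if and only if $q\equiv\pm2$ and $p\equiv q \pmod 5$; * $[-2]$ if and only if $q\equiv\pm1$ and $p\equiv-2q \pmod 5$; * $[\frac12]$ if and only if $q\equiv\pm2$ and $p\equiv-2q \pmod 5$; * $[2]$ if and only if $q\equiv\pm1$ and $p\equiv2q \pmod 5$; * $[-\frac12]$ if and only if $q\equiv\pm2$ and $p\equiv2q \pmod 5$. Moreover, two rational tangles $[\frac pq]$ and $[\frac{p'}{q'}]$ are 5-move equivalent if and only if either $q\equiv q'$ and $p\equiv p' \pmod 5$, or $q\equiv-q'$ and $p\equiv-p' \pmod 5$. -/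

import Mathlib

/-!
Unoriented tangles in a rectangle times an interval (a 3-ball), presented by generic planar diagrams.
A diagram is read from left to right. At every moment it is crossed by finitely many strands, numbered
`0, 1, 2, …` from top to bottom, and it is a finite sequence of elementary events: a strand turns back
(`⊂` or `⊃`) or two neighbouring strands cross. Two diagrams present isotopic tangles (the isotopy
fixing the boundary of the ball) if and only if they are related by level-preserving planar isotopy
together with the moves `IsotopyMove` below, which are the planar and Reidemeister moves for
diagrams that are generic with respect to the left-to-right direction.
-/

namespace FiveMoves

/-- The elementary events of a diagram read from left to right. -/
inductive Piece
  /-- `⊂`: two neighbouring strands, joined at their left ends, come into being. -/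
  | birth
  /-- `⊃`: two neighbouring strands are joined at their right ends and disappear. -/
  | death
  /-- A crossing of two neighbouring strands; the strand that descends (from upper left to lower
  right) is the overpass. -/
  | pos
  /-- A crossing of two neighbouring strands; the strand that descends (from upper left to lower
  right) is the underpass. -/
  | neg

namespace Piece

/-- Number of strands entering on the left. -/
def ins : Piece → ℕ
  | birth => 0
  | death => 2
  | pos => 2
  | neg => 2

/-- Number of strands leaving on the right. -/
def outs : Piece → ℕ
  | birth => 2
  | death => 0
  | pos => 2
  | neg => 2

/-- Interchange over- and underpass. -/
def mirror : Piece → Piece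
  | birth => birth
  | death => death
  | pos => neg
  | neg => pos

end Piece

/-- A sequence of events; `(e, i)` is the event `e` taking place below exactly `i` strands, so its
first strand has number `i`. -/
abbrev Word := List (Piece × ℕ)

/-- `Runs w m n`: the word `w` is a diagram with `m` end points on the left and `n` end points on the
right. -/
def Runs : Word → ℕ → ℕ → Prop
  | [], m, n => m = n
  | (e, i) :: w, m, n => i + e.ins ≤ m ∧ Runs w (m - e.ins + e.outs) n

/-- Tangle diagrams with `m` end points on the left and `n` end points on the right. -/
def Diagram (m n : ℕ) : Type := {w : Word // Runs w m n}

/-- Diagrams of 2-tangles: end points NW, SW (strands `0`, `1` on the left) and NE, SE (strands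
`0`, `1` on the right). -/
abbrev TwoTangle : Type := Diagram 2 2

/-! ### Isotopy and 5-moves -/

open Piece in
/-- The local moves that generate isotopy of tangles. -/
inductive IsotopyMove : Word → Word → Prop
  /-- Two events with disjoint sets of strands, the second one below the first one, may be
  interchanged. -/
  | far (e f : Piece) (i k : ℕ) :
      IsotopyMove [(e, i), (f, i + e.outs + k)] [(f, i + e.ins + k), (e, i)]
  /-- Straightening an `S`-shaped strand. -/
  | zigzag₁ (i : ℕ) : IsotopyMove [(birth, i), (death, i + 1)] []
  | zigzag₂ (i : ℕ) : IsotopyMove [(birth, i + 1), (death, i)] []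
  /-- A strand passes under, or over, a turning point. -/
  | slide₁ (i : ℕ) : IsotopyMove [(birth, i), (pos, i + 1)] [(birth, i + 1), (neg, i)]
  | slide₂ (i : ℕ) : IsotopyMove [(birth, i), (neg, i + 1)] [(birth, i + 1), (pos, i)]
  | slide₃ (i : ℕ) : IsotopyMove [(pos, i + 1), (death, i)] [(neg, i), (death, i + 1)]
  | slide₄ (i : ℕ) : IsotopyMove [(neg, i + 1), (death, i)] [(pos, i), (death, i + 1)]
  /-- First Reidemeister move. -/
  | kink₁ (i : ℕ) : IsotopyMove [(birth, i), (pos, i)] [(birth, i)]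
  | kink₂ (i : ℕ) : IsotopyMove [(birth, i), (neg, i)] [(birth, i)]
  | kink₃ (i : ℕ) : IsotopyMove [(pos, i), (death, i)] [(death, i)]
  | kink₄ (i : ℕ) : IsotopyMove [(neg, i), (death, i)] [(death, i)]
  /-- Second Reidemeister move. -/
  | cancel₁ (i : ℕ) : IsotopyMove [(pos, i), (neg, i)] []
  | cancel₂ (i : ℕ) : IsotopyMove [(neg, i), (pos, i)] []
  /-- Third Reidemeister move. -/
  | braid (i : ℕ) :
      IsotopyMove [(pos, i), (pos, i + 1), (pos, i)] [(pos, i + 1), (pos, i), (pos, i + 1)]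

/-- The `±5`-move: two parallel strands are replaced by five half-twists of one and the same sign. -/
inductive FiveMove : Word → Word → Prop
  | plus (i : ℕ) : FiveMove [] (List.replicate 5 (Piece.pos, i))
  | minus (i : ℕ) : FiveMove [] (List.replicate 5 (Piece.neg, i))

/-- A local move `R` applied somewhere inside a diagram. -/
def Step (R : Word → Word → Prop) {m n : ℕ} (D D' : Diagram m n) : Prop :=
  ∃ u a b v : Word, R a b ∧ D.1 = u ++ a ++ v ∧ D'.1 = u ++ b ++ v

/-- Isotopy of tangles relative to the boundary. -/
def Isotopic {m n : ℕ} : Diagram m n → Diagram m n → Prop :=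
  Relation.EqvGen (Step IsotopyMove)

/-- 5-move equivalence: related by a finite sequence of isotopies, `±5`-moves and their inverses. -/
def FiveMoveEquiv {m n : ℕ} : Diagram m n → Diagram m n → Prop :=
  Relation.EqvGen fun D D' => Step IsotopyMove D D' ∨ Step FiveMove D D'

/-! ### Rational tangles -/

theorem runs_append {w w' : Word} {m n k : ℕ} (h : Runs w m n) (h' : Runs w' n k) :
    Runs (w ++ w') m k := by
  induction w generalizing m with
  | nil => cases h; exact h'
  | cons a w ih => exact ⟨h.1, ih h.2⟩

/-- The mirror image in the plane of the diagram: all crossings are changed. -/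
def mirrorWord (w : Word) : Word := w.map fun x => (x.1.mirror, x.2)

/-- Put `s` strands above a diagram. -/
def shiftWord (s : ℕ) (w : Word) : Word := w.map fun x => (x.1, s + x.2)

theorem runs_mirror {w : Word} {m n : ℕ} (h : Runs w m n) : Runs (mirrorWord w) m n := by
  induction w generalizing m with
  | nil => exact h
  | cons a w ih =>
    obtain ⟨e, i⟩ := a
    have hi : e.mirror.ins = e.ins := by cases e <;> rfl
    have ho : e.mirror.outs = e.outs := by cases e <;> rfl
    have h1 : i + e.ins ≤ m := h.1
    have h2 : Runs (mirrorWord w) (m - e.ins + e.outs) n := ih h.2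
    rw [← hi] at h1
    rw [← hi, ← ho] at h2
    exact ⟨h1, h2⟩

theorem runs_shift {w : Word} {m n : ℕ} (s t : ℕ) (h : Runs w m n) :
    Runs (shiftWord s w) (s + m + t) (s + n + t) := by
  induction w generalizing m with
  | nil => cases h; rfl
  | cons a w ih =>
    obtain ⟨e, i⟩ := a
    have h1 : i + e.ins ≤ m := h.1
    refine ⟨by show s + i + e.ins ≤ s + m + t; omega, ?_⟩
    have h2 := ih h.2
    have h3 : s + (m - e.ins + e.outs) + t = s + m + t - e.ins + e.outs := by omega
    rw [h3] at h2
    exact h2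

/-- The tangle sum: `T'` is placed to the right of `T`. -/
def add (T T' : TwoTangle) : TwoTangle := ⟨T.1 ++ T'.1, runs_append T.2 T'.2⟩

theorem runs_replicate (e : Piece) (hi : e.ins = 2) (ho : e.outs = 2) (k : ℕ) :
    Runs (List.replicate k (e, 0)) 2 2 := by
  induction k with
  | zero => rfl
  | succ k ih =>
    refine ⟨by simp [hi], ?_⟩
    simpa [hi, ho] using ih

/-- The integer tangle `[a]`: `|a|` horizontal half-twists, of sign that of `a`. In particular `[0]`
consists of two horizontal strands. -/
def integerTangle (a : ℤ) : TwoTangle :=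
  ⟨List.replicate a.natAbs (if 0 ≤ a then Piece.pos else Piece.neg, 0), by
    split_ifs <;> exact runs_replicate _ rfl rfl _⟩

/-- The tangle `[∞] = [1/0]`, of the shape `⊃⊂`. -/
def infinityTangle : TwoTangle :=
  ⟨[(Piece.death, 0), (Piece.birth, 0)], by simp [Runs, Piece.ins, Piece.outs]⟩

/-- Inversion of tangles: rotate counterclockwise by a quarter turn (NW goes to SW, SW to SE, SE to NE
and NE to NW) and take the mirror image. It turns the rational tangle `[x]` into `[1/x]`. -/
def inversion (T : TwoTangle) : TwoTangle :=
  ⟨(Piece.birth, 2) :: (shiftWord 1 (mirrorWord T.1) ++ [(Piece.death, 0)]), by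
    refine ⟨by simp [Piece.ins], ?_⟩
    exact runs_append (runs_shift 1 1 (runs_mirror T.2)) (by simp [Runs, Piece.ins, Piece.outs])⟩

/-- The standard diagram of the rational tangle `[a₀ + 1/(a₁ + 1/(a₂ + ⋯))]`; the empty continued
fraction stands for `1/0`. -/
def conway : List ℤ → TwoTangle
  | [] => infinityTangle
  | a :: l => add (inversion (conway l)) (integerTangle a)

/-- Numerator and denominator of `a₀ + 1/(a₁ + 1/(a₂ + ⋯))`, the empty continued fraction being
`1/0`. -/
def fraction : List ℤ → ℤ × ℤ
  | [] => (1, 0)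
  | a :: l => (a * (fraction l).1 + (fraction l).2, (fraction l).1)

/-- `T` is (a diagram of) the rational tangle `[p/q]`, where `p` and `q` are coprime integers: `T` is
isotopic to the tangle of a continued fraction expansion of `p/q`. Coprimality is automatic, and
`p/q` and `(-p)/(-q)` are the same fraction. -/
def IsRational (p q : ℤ) (T : TwoTangle) : Prop :=
  ∃ l : List ℤ, (fraction l = (p, q) ∨ fraction l = (-p, -q)) ∧ Isotopic T (conway l)

/-- `T` lies in the 5-move equivalence class of the rational tangle `[r/s]`. -/
def InClass (r s : ℤ) (T : TwoTangle) : Prop :=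
  ∃ R : TwoTangle, IsRational r s R ∧ FiveMoveEquiv T R

/-- The fractions of the twelve tangles `[1/0]`, `[0]`, `[-1]`, `[1]`, `[-2]`, `[2]`, `[2/5]`,
`[5/2]`, `[3/2]`, `[-3/2]`, `[1/2]`, `[-1/2]`, as pairs of numerator and denominator. -/
def twelveFractions : Finset (ℤ × ℤ) :=
  {(1, 0), (0, 1), (-1, 1), (1, 1), (-2, 1), (2, 1), (2, 5), (5, 2), (3, 2), (-3, 2), (1, 2), (-1, 2)}

/-- Every fraction in lowest terms has a continued fraction expansion, so `[p/q]` exists. -/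
theorem exists_isRational (p q : ℤ) (h : IsCoprime p q) : ∃ T, IsRational p q T := by
  suffices H : ∀ (n : ℕ) (p q : ℤ), q.natAbs = n → IsCoprime p q →
      ∃ l, fraction l = (p, q) ∨ fraction l = (-p, -q) by
    obtain ⟨l, hl⟩ := H _ p q rfl h
    exact ⟨conway l, l, hl, Relation.EqvGen.refl _⟩
  intro n
  induction n using Nat.strong_induction_on with
  | _ n ih =>
    intro p q hn hc
    by_cases hq : q = 0
    · subst hq
      have hu : IsUnit p := isCoprime_zero_right.mp hc
      rcases Int.isUnit_iff.mp hu with rfl | rfl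
      · exact ⟨[], Or.inl rfl⟩
      · exact ⟨[], Or.inr rfl⟩
    · have hlt : (p % q).natAbs < n := by
        have h1 := Int.emod_nonneg p hq
        have h2 := Int.emod_lt_abs p hq
        rw [Int.abs_eq_natAbs] at h2
        omega
      have hc' : IsCoprime q (p % q) := by
        have h3 : p % q = p + q * (-(p / q)) := by
          have := Int.emod_add_mul_ediv p q
          linarith
        rw [h3]
        exact hc.symm.add_mul_left_right _
      have hp := Int.emod_add_mul_ediv p q
      obtain ⟨l, hl | hl⟩ := ih _ hlt q (p % q) rfl hc'
      · refine ⟨(p / q) :: l, Or.inl ?_⟩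
        simp only [fraction, hl, Prod.mk.injEq, and_true]
        linarith
      · refine ⟨(p / q) :: l, Or.inr ?_⟩
        simp only [fraction, hl, Prod.mk.injEq, and_true]
        linarith

end FiveMoves

open FiveMoves

/-!
Lower bound. Evaluate diagrams by the Kauffman bracket at a primitive eighth root of unity, where a
closed loop counts zero. After rescaling, a crossing becomes `1 ± j • U` with `j ^ 2 = -1` and `U`
the diagram `⊃⊂`, so that `U ^ 2 = 0`; five half-twists give `1 ± 5 • j • U`, which is `1` over a
ring with `5 = 0`. Up to powers of `j`, the value of a diagram is invariant under isotopy, and that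
of `[p/q]` is `q + j * p • U`. Hence 5-move equivalence determines `±(p, q)` modulo `5`.

Upper bound. Bend the left end points of a tangle to the right, so that the braid group on four
strands acts on the four end points by half-twists, which have order five up to 5-moves. All
rational tangles lie in one orbit, on which the first and the last half-twist agree, and the
relations of the braid group on three strands bound this orbit by twelve points, arranged like the
vertices of an icosahedron. The twelve representatives are pairwise inequivalent by the lower bound,
so they fill it.
-/

namespace FiveMoves

/-- The congruence `±(p, q) ≡ (p', q')` of pairs of integers modulo `n`: the relation between the
fractions `p/q` and `p'/q'` that does not depend on the signs of numerator and denominator. -/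
def ModEqUpToSign (n : ℤ) (v w : ℤ × ℤ) : Prop :=
  (v.2 ≡ w.2 [ZMOD n] ∧ v.1 ≡ w.1 [ZMOD n]) ∨ (v.2 ≡ -w.2 [ZMOD n] ∧ v.1 ≡ -w.1 [ZMOD n])

namespace ModEqUpToSign

variable {n : ℤ} {u v w : ℤ × ℤ}

theorem refl (v : ℤ × ℤ) : ModEqUpToSign n v v := Or.inl ⟨rfl, rfl⟩

theorem neg_left (h : ModEqUpToSign n v w) : ModEqUpToSign n (-v) w :=
  h.symm.imp (fun h => ⟨by simpa using h.1.neg, by simpa using h.2.neg⟩)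
    fun h => ⟨h.1.neg, h.2.neg⟩

theorem symm (h : ModEqUpToSign n v w) : ModEqUpToSign n w v :=
  h.imp (fun h => ⟨h.1.symm, h.2.symm⟩)
    fun h => ⟨by simpa using h.1.symm.neg, by simpa using h.2.symm.neg⟩

theorem trans (h : ModEqUpToSign n u v) (h' : ModEqUpToSign n v w) : ModEqUpToSign n u w := by
  rcases h with h | h
  · exact h'.imp (fun h' => ⟨h.1.trans h'.1, h.2.trans h'.2⟩)
      fun h' => ⟨h.1.trans h'.1, h.2.trans h'.2⟩
  · exact h'.neg_left.imp (fun h' => ⟨h.1.trans h'.1, h.2.trans h'.2⟩)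
      fun h' => ⟨h.1.trans h'.1, h.2.trans h'.2⟩

end ModEqUpToSign

theorem modEqUpToSign_iff_of_modEq_mul {n a p q r s : ℤ} (h : r ≡ a * s [ZMOD n]) :
    ModEqUpToSign n (p, q) (r, s) ↔
      (q ≡ s [ZMOD n] ∨ q ≡ -s [ZMOD n]) ∧ p ≡ a * q [ZMOD n] := by
  have hpos : q ≡ s [ZMOD n] → (p ≡ r [ZMOD n] ↔ p ≡ a * q [ZMOD n]) := fun hq =>
    have hr : r ≡ a * q [ZMOD n] := h.trans (hq.symm.mul_left a)
    ⟨fun hp => hp.trans hr, fun hp => hp.trans hr.symm⟩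
  have hneg : q ≡ -s [ZMOD n] → (p ≡ -r [ZMOD n] ↔ p ≡ a * q [ZMOD n]) := fun hq =>
    have hr : -r ≡ a * q [ZMOD n] := by simpa using h.neg.trans (by simpa using hq.symm.mul_left a)
    ⟨fun hp => hp.trans hr, fun hp => hp.trans hr.symm⟩
  rw [or_and_right]
  exact or_congr (and_congr_right hpos) (and_congr_right hneg)

theorem modEqUpToSign_iff_of_modEq_zero {n p q r s : ℤ} (h : s ≡ 0 [ZMOD n]) :
    ModEqUpToSign n (p, q) (r, s) ↔
      q ≡ 0 [ZMOD n] ∧ (p ≡ r [ZMOD n] ∨ p ≡ -r [ZMOD n]) := by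
  have hpos : q ≡ s [ZMOD n] ↔ q ≡ 0 [ZMOD n] := ⟨fun hq => hq.trans h, fun hq => hq.trans h.symm⟩
  have hneg : q ≡ -s [ZMOD n] ↔ q ≡ 0 [ZMOD n] :=
    ⟨fun hq => hq.trans (by simpa using h.neg), fun hq => hq.trans (by simpa using h.symm.neg)⟩
  simp only [ModEqUpToSign, hpos, hneg, and_or_left]

theorem eq_of_mem_twelveFractions {v w : ℤ × ℤ} (hv : v ∈ twelveFractions)
    (hw : w ∈ twelveFractions) (h : ModEqUpToSign 5 v w) : v = w := by
  have key : ∀ v ∈ twelveFractions, ∀ w ∈ twelveFractions, ModEqUpToSign 5 v w → v = w := by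
    unfold ModEqUpToSign Int.ModEq
    decide
  exact key v hv w hw h

theorem isCoprime_of_mem_twelveFractions {v : ℤ × ℤ} (hv : v ∈ twelveFractions) :
    IsCoprime v.1 v.2 := by
  rw [Int.isCoprime_iff_gcd_eq_one]
  revert v
  decide

/-! ### Rational tangles -/

/-- The mirror image of a tangle: all crossings are switched. -/
def mirror (T : TwoTangle) : TwoTangle := ⟨mirrorWord T.1, runs_mirror T.2⟩

/-- A tangle rotated by a quarter turn, such that `inversion` is the rotation of the mirror
image. -/
def rotation (T : TwoTangle) : TwoTangle :=
  ⟨(Piece.birth, 2) :: (shiftWord 1 T.1 ++ [(Piece.death, 0)]), ⟨le_rfl,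
    runs_append (runs_shift 1 1 T.2) ⟨by decide, rfl⟩⟩⟩

theorem inversion_eq_rotation_mirror (T : TwoTangle) : inversion T = rotation (mirror T) := rfl

theorem mirrorWord_mirrorWord (w : Word) : mirrorWord (mirrorWord w) = w := by
  have h (e : Piece) : e.mirror.mirror = e := by cases e <;> rfl
  simp [mirrorWord, Function.comp_def, h]

theorem mirrorWord_append (w w' : Word) :
    mirrorWord (w ++ w') = mirrorWord w ++ mirrorWord w' := List.map_append

theorem mirrorWord_shiftWord (s : ℕ) (w : Word) :
    mirrorWord (shiftWord s w) = shiftWord s (mirrorWord w) := by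
  simp [mirrorWord, shiftWord, Function.comp_def]

theorem mirror_add (T T' : TwoTangle) : mirror (add T T') = add (mirror T) (mirror T') :=
  Subtype.ext (mirrorWord_append ..)

theorem mirror_rotation (T : TwoTangle) : mirror (rotation T) = rotation (mirror T) := by
  apply Subtype.ext
  change (Piece.birth, 2) :: mirrorWord (shiftWord 1 T.1 ++ [(Piece.death, 0)]) = _
  rw [mirrorWord_append, mirrorWord_shiftWord]
  rfl

theorem mirror_mirror (T : TwoTangle) : mirror (mirror T) = T :=
  Subtype.ext (mirrorWord_mirrorWord T.1)

theorem mirror_integerTangle (a : ℤ) : mirror (integerTangle a) = integerTangle (-a) := by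
  apply Subtype.ext
  simp only [mirror, mirrorWord, integerTangle, List.map_replicate, Int.natAbs_neg]
  rcases lt_trichotomy a 0 with ha | rfl | ha
  · rw [if_neg ha.not_ge, if_pos (by omega)]
    rfl
  · rfl
  · rw [if_pos ha.le, if_neg (by omega)]
    rfl

theorem conway_induction {P : ℤ → ℤ → TwoTangle → Prop} (infinity : P 1 0 infinityTangle)
    (neg : ∀ {p q T}, P p q T → P (-p) (-q) T)
    (rotation : ∀ {p q T}, P p q T → P (-q) p (rotation T))
    (add : ∀ {p q T} (a : ℤ), P p q T → P (p + a * q) q (add T (integerTangle a))) (l : List ℤ) :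
    P (fraction l).1 (fraction l).2 (conway l) := by
  suffices P (fraction l).1 (fraction l).2 (conway l) ∧
      P (fraction l).1 (-(fraction l).2) (mirror (conway l)) from this.1
  induction l with
  | nil => exact ⟨infinity, infinity⟩
  | cons a l ih =>
    constructor
    · simpa [conway, fraction, inversion_eq_rotation_mirror, add_comm] using add a (rotation ih.2)
    · simpa [conway, fraction, inversion_eq_rotation_mirror, mirror_add, mirror_rotation,
        mirror_mirror, mirror_integerTangle] using neg (add (-a) (rotation ih.1))

theorem isCoprime_fraction (l : List ℤ) : IsCoprime (fraction l).1 (fraction l).2 :=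
  conway_induction (P := fun p q _ => IsCoprime p q) isCoprime_one_left (·.neg_neg)
    (·.symm.neg_left) (fun _ h => h.add_mul_right_left _) l

/-! ### Temperley–Lieb operators -/

theorem one_add_smul_braid {R A : Type*} [CommRing R] [Ring A] [Algebra R A] {c : R}
    (hc : c * c = -1) {x y : A} (hx : x * x = 0) (hxy : x * y * x = x) :
    (1 + c • x) * (1 + c • y) * (1 + c • x) = 1 + c • x + c • y - x * y - y * x := by
  simp only [add_mul, mul_add, one_mul, mul_one, smul_mul_assoc, mul_smul_comm, hx, hxy,
    smul_add, smul_smul, hc, smul_zero, neg_smul, one_smul, neg_mul, smul_neg, add_zero]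
  module

/-- Operators `birth` and `death` that evaluate diagrams: a word is read as a product from left to
right, and `shift` adds a strand above. The relations are planar isotopy, and a closed loop counts
zero. -/
structure TangleAlgebra (R A : Type*) [CommRing R] [Ring A] [Algebra R A] where
  shift : A →ₐ[R] A
  birth : A
  death : A
  birth_mul_shift_shift (x : A) : birth * shift (shift x) = x * birth
  death_mul (x : A) : death * x = shift (shift x) * death
  birth_mul_death : birth * death = 0
  birth_mul_shift_death : birth * shift death = 1
  shift_birth_mul_death : shift birth * death = 1

namespace TangleAlgebra

variable {R A : Type*} [CommRing R] [Ring A] [Algebra R A] (𝒯 : TangleAlgebra R A)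

/-- The Temperley–Lieb generator, the value of the diagram `⊃⊂`. -/
def cupCap : A := 𝒯.death * 𝒯.birth

/-- The value of a crossing is a combination of its two smoothings, as in the Kauffman bracket; it
is normalised such that the horizontal smoothing has coefficient one. -/
def crossing (c : R) : A := 1 + c • 𝒯.cupCap

theorem birth_mul_cupCap : 𝒯.birth * 𝒯.cupCap = 0 := by
  rw [cupCap, ← mul_assoc, 𝒯.birth_mul_death, zero_mul]

theorem cupCap_mul_death : 𝒯.cupCap * 𝒯.death = 0 := by
  rw [cupCap, mul_assoc, 𝒯.birth_mul_death, mul_zero]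

theorem cupCap_mul_cupCap : 𝒯.cupCap * 𝒯.cupCap = 0 := by
  rw [cupCap, ← mul_assoc, ← cupCap, cupCap_mul_death, zero_mul]

theorem birth_mul_shift_cupCap : 𝒯.birth * 𝒯.shift 𝒯.cupCap = 𝒯.shift 𝒯.birth := by
  rw [cupCap, map_mul, ← mul_assoc, 𝒯.birth_mul_shift_death, one_mul]

theorem shift_birth_mul_cupCap : 𝒯.shift 𝒯.birth * 𝒯.cupCap = 𝒯.birth := by
  rw [cupCap, ← mul_assoc, 𝒯.shift_birth_mul_death, one_mul]

theorem shift_cupCap_mul_death : 𝒯.shift 𝒯.cupCap * 𝒯.death = 𝒯.shift 𝒯.death := by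
  rw [cupCap, map_mul, mul_assoc, 𝒯.shift_birth_mul_death, mul_one]

theorem cupCap_mul_shift_death : 𝒯.cupCap * 𝒯.shift 𝒯.death = 𝒯.death := by
  rw [cupCap, mul_assoc, 𝒯.birth_mul_shift_death, mul_one]

theorem cupCap_mul_shift_cupCap_mul_cupCap :
    𝒯.cupCap * 𝒯.shift 𝒯.cupCap * 𝒯.cupCap = 𝒯.cupCap := by
  nth_rw 3 [cupCap]
  rw [mul_assoc, ← mul_assoc _ 𝒯.death, shift_cupCap_mul_death, ← mul_assoc,
    cupCap_mul_shift_death, cupCap]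

theorem shift_cupCap_mul_cupCap_mul_shift_cupCap :
    𝒯.shift 𝒯.cupCap * 𝒯.cupCap * 𝒯.shift 𝒯.cupCap = 𝒯.shift 𝒯.cupCap := by
  nth_rw 2 [cupCap]
  rw [← mul_assoc, shift_cupCap_mul_death, mul_assoc, birth_mul_shift_cupCap, ← map_mul, cupCap]

theorem crossing_zero : 𝒯.crossing 0 = 1 := by simp [crossing]

theorem crossing_mul_crossing (c c' : R) :
    𝒯.crossing c * 𝒯.crossing c' = 𝒯.crossing (c + c') := by
  simp only [crossing, mul_add, add_mul, mul_one, one_mul, smul_mul_smul_comm, cupCap_mul_cupCap,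
    smul_zero, add_zero, add_smul, add_assoc]

theorem crossing_pow (c : R) (n : ℕ) : 𝒯.crossing c ^ n = 𝒯.crossing (n * c) := by
  induction n with
  | zero => simp [crossing_zero]
  | succ n ih => rw [pow_succ, ih, crossing_mul_crossing, Nat.cast_succ, add_one_mul]

theorem birth_mul_crossing (c : R) : 𝒯.birth * 𝒯.crossing c = 𝒯.birth := by
  simp [crossing, mul_add, birth_mul_cupCap]

theorem crossing_mul_death (c : R) : 𝒯.crossing c * 𝒯.death = 𝒯.death := by
  simp [crossing, add_mul, cupCap_mul_death]

theorem birth_mul_shift_crossing {c : R} (hc : c * c = -1) :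
    𝒯.birth * 𝒯.shift (𝒯.crossing c) = c • (𝒯.shift 𝒯.birth * 𝒯.crossing (-c)) := by
  simp only [crossing, map_add, map_one, map_smul, mul_add, mul_one, mul_smul_comm, smul_add,
    birth_mul_shift_cupCap, shift_birth_mul_cupCap, smul_smul, mul_neg, hc, neg_neg, one_smul,
    add_comm]

theorem shift_crossing_mul_death {c : R} (hc : c * c = -1) :
    𝒯.shift (𝒯.crossing c) * 𝒯.death = c • (𝒯.crossing (-c) * 𝒯.shift 𝒯.death) := by
  simp only [crossing, map_add, map_one, map_smul, add_mul, one_mul, smul_mul_assoc, smul_add,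
    shift_cupCap_mul_death, cupCap_mul_shift_death, smul_smul, mul_neg, hc, neg_neg, one_smul,
    add_comm]

theorem crossing_braid {c : R} (hc : c * c = -1) :
    𝒯.crossing c * 𝒯.shift (𝒯.crossing c) * 𝒯.crossing c =
      𝒯.shift (𝒯.crossing c) * 𝒯.crossing c * 𝒯.shift (𝒯.crossing c) := by
  have hσ : 𝒯.shift (𝒯.crossing c) = 1 + c • 𝒯.shift 𝒯.cupCap := by simp [crossing]
  rw [hσ, crossing,
    one_add_smul_braid hc 𝒯.cupCap_mul_cupCap 𝒯.cupCap_mul_shift_cupCap_mul_cupCap,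
    one_add_smul_braid hc (by rw [← map_mul, cupCap_mul_cupCap, map_zero])
      𝒯.shift_cupCap_mul_cupCap_mul_shift_cupCap]
  abel

end TangleAlgebra

/-! ### The bracket of a diagram -/

/-- The moves that generate 5-move equivalence. -/
def LocalMove (a b : Word) : Prop := IsotopyMove a b ∨ FiveMove a b

theorem fiveMoveEquiv_eq {m n : ℕ} :
    (FiveMoveEquiv : Diagram m n → Diagram m n → Prop) = Relation.EqvGen (Step LocalMove) := by
  have h (D D' : Diagram m n) :
      (Step IsotopyMove D D' ∨ Step FiveMove D D') = Step LocalMove D D' := by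
    simp only [Step, LocalMove, or_and_right, exists_or]
  simp only [FiveMoveEquiv, h]

theorem FiveMoveEquiv.of_step {m n : ℕ} {r : Diagram m n → Diagram m n → Prop} (hr : Equivalence r)
    (hstep : ∀ D D', Step LocalMove D D' → r D D') {D D' : Diagram m n}
    (h : FiveMoveEquiv D D') : r D D' := by
  rw [fiveMoveEquiv_eq] at h
  exact hr.eqvGen_iff.1 (h.mono hstep)

theorem Isotopic.fiveMoveEquiv {m n : ℕ} {D D' : Diagram m n} (h : Isotopic D D') :
    FiveMoveEquiv D D' := h.mono fun _ _ => Or.inl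

theorem shiftWord_nil (s : ℕ) : shiftWord s [] = [] := rfl

theorem shiftWord_cons (s : ℕ) (e : Piece) (i : ℕ) (w : Word) :
    shiftWord s ((e, i) :: w) = (e, s + i) :: shiftWord s w := rfl

theorem shiftWord_append (s : ℕ) (w w' : Word) :
    shiftWord s (w ++ w') = shiftWord s w ++ shiftWord s w' := List.map_append

/-- Equality up to a power of `j`. -/
def EqUpToPow {R M : Type*} [Monoid R] [MulAction R M] (j : R) (x y : M) : Prop :=
  ∃ k : ℕ, x = j ^ k • y

namespace EqUpToPow

theorem of_eq {R M : Type*} [Monoid R] [MulAction R M] (j : R) {x y : M} (h : x = y) :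
    EqUpToPow j x y := ⟨0, by simpa using h⟩

theorem equivalence {R M : Type*} [Monoid R] [MulAction R M] {j : R} {n : ℕ}
    (hj : j ^ (n + 1) = 1) :
    Equivalence (EqUpToPow j : M → M → Prop) where
  refl _ := of_eq j rfl
  symm := by
    rintro x y ⟨k, rfl⟩
    exact ⟨n * k, by rw [smul_smul, ← pow_add, ← Nat.succ_mul, pow_mul, hj, one_pow, one_smul]⟩
  trans := by
    rintro x y z ⟨k, rfl⟩ ⟨l, rfl⟩
    exact ⟨k + l, by rw [pow_add, mul_smul]⟩

variable {R A : Type*} [CommRing R] [Ring A] [Algebra R A] {j : R} {x y x' y' : A}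

theorem mul (h : EqUpToPow j x y) (h' : EqUpToPow j x' y') : EqUpToPow j (x * x') (y * y') := by
  obtain ⟨k, rfl⟩ := h
  obtain ⟨l, rfl⟩ := h'
  exact ⟨k + l, by rw [smul_mul_smul_comm, pow_add]⟩

theorem smul_self (j : R) (x : A) : EqUpToPow j (j • x) x := ⟨1, by rw [pow_one]⟩

theorem neg_smul_self (hj : j * j = -1) (x : A) : EqUpToPow j (-j • x) x :=
  ⟨3, by rw [pow_succ, pow_two, hj, neg_one_mul]⟩

theorem map (σ : A →ₐ[R] A) (h : EqUpToPow j x y) : EqUpToPow j (σ x) (σ y) := by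
  obtain ⟨k, rfl⟩ := h
  exact ⟨k, map_smul ..⟩

end EqUpToPow

namespace TangleAlgebra

variable {R A : Type*} [CommRing R] [Ring A] [Algebra R A] (𝒯 : TangleAlgebra R A) (j : R)

/-- The value of an event at the top of a diagram. -/
def pieceValue : Piece → A
  | .birth => 𝒯.birth
  | .death => 𝒯.death
  | .pos => 𝒯.crossing j
  | .neg => 𝒯.crossing (-j)

/-- The value of a diagram, a version of its Kauffman bracket. -/
def eval (w : Word) : A := (w.map fun x => (𝒯.shift ^ x.2) (𝒯.pieceValue j x.1)).prod

theorem eval_nil : 𝒯.eval j [] = 1 := rfl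

theorem eval_cons (e : Piece) (i : ℕ) (w : Word) :
    𝒯.eval j ((e, i) :: w) = (𝒯.shift ^ i) (𝒯.pieceValue j e) * 𝒯.eval j w := List.prod_cons

theorem eval_append (w w' : Word) : 𝒯.eval j (w ++ w') = 𝒯.eval j w * 𝒯.eval j w' := by
  rw [eval, List.map_append, List.prod_append, eval, eval]

theorem eval_shiftWord (s : ℕ) (w : Word) :
    𝒯.eval j (shiftWord s w) = (𝒯.shift ^ s) (𝒯.eval j w) := by
  simp only [eval, shiftWord, List.map_map, map_list_prod, Function.comp_def, pow_add,
    AlgHom.mul_apply]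

theorem pieceValue_mul_shift (e : Piece) (x : A) :
    𝒯.pieceValue j e * (𝒯.shift ^ e.outs) x = (𝒯.shift ^ e.ins) x * 𝒯.pieceValue j e := by
  have hcrossing (c : R) : 𝒯.crossing c * 𝒯.shift (𝒯.shift x) =
      𝒯.shift (𝒯.shift x) * 𝒯.crossing c := by
    simp only [crossing, cupCap, add_mul, mul_add, one_mul, mul_one, smul_mul_assoc, mul_smul_comm,
      mul_assoc, birth_mul_shift_shift]
    rw [← mul_assoc, death_mul, mul_assoc]
  cases e with
  | birth => exact 𝒯.birth_mul_shift_shift x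
  | death => exact 𝒯.death_mul x
  | pos => exact hcrossing j
  | neg => exact hcrossing (-j)

variable {j}

theorem eval_far (j : R) (e f : Piece) (i k : ℕ) :
    𝒯.eval j [(e, i), (f, i + e.outs + k)] = 𝒯.eval j [(f, i + e.ins + k), (e, i)] := by
  have h := congrArg (𝒯.shift ^ i)
    (𝒯.pieceValue_mul_shift j e ((𝒯.shift ^ k) (𝒯.pieceValue j f)))
  simpa only [eval_cons, eval_nil, mul_one, map_mul, pow_add, AlgHom.mul_apply] using h

theorem eqUpToPow_of_isotopyMove (hj : j * j = -1) {a b : Word} (h : IsotopyMove a b) :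
    EqUpToPow j (𝒯.eval j a) (𝒯.eval j b) := by
  have hj' : -j * -j = -1 := by rwa [neg_mul_neg]
  cases h with
  | far e f i k => exact .of_eq j (𝒯.eval_far j e f i k)
  | slide₁ i | slide₃ i =>
    simp only [eval_cons, eval_nil, mul_one, pow_succ, AlgHom.mul_apply, pieceValue, ← map_mul,
      𝒯.birth_mul_shift_crossing hj, 𝒯.shift_crossing_mul_death hj]
    exact (EqUpToPow.smul_self j _).map _
  | slide₂ i | slide₄ i =>
    simp only [eval_cons, eval_nil, mul_one, pow_succ, AlgHom.mul_apply, pieceValue, ← map_mul,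
      𝒯.birth_mul_shift_crossing hj', 𝒯.shift_crossing_mul_death hj', neg_neg]
    exact (EqUpToPow.neg_smul_self hj _).map _
  | zigzag₁ i | zigzag₂ i | kink₁ i | kink₂ i | kink₃ i | kink₄ i | cancel₁ i | cancel₂ i
  | braid i =>
    refine .of_eq j ?_
    simp only [eval_cons, eval_nil, mul_one, pow_succ, AlgHom.mul_apply, pieceValue, ← map_mul,
      ← mul_assoc, birth_mul_shift_death, shift_birth_mul_death, birth_mul_crossing,
      crossing_mul_death, crossing_mul_crossing, add_neg_cancel, neg_add_cancel, crossing_zero,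
      map_one, 𝒯.crossing_braid hj]

theorem eval_eq_of_fiveMove (h5 : (5 : R) = 0) {a b : Word} (h : FiveMove a b) :
    𝒯.eval j a = 𝒯.eval j b := by
  have key (c : R) : 𝒯.crossing c ^ 5 = 1 := by
    rw [crossing_pow, Nat.cast_ofNat, h5, zero_mul, crossing_zero]
  cases h with
  | plus i | minus i =>
    rw [eval, eval, List.map_replicate, List.prod_replicate, ← map_pow, pieceValue, key, map_one,
      List.map_nil, List.prod_nil]

theorem eqUpToPow_of_fiveMoveEquiv (hj : j * j = -1) (h5 : (5 : R) = 0) {m n : ℕ}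
    {D D' : Diagram m n} (h : FiveMoveEquiv D D') :
    EqUpToPow j (𝒯.eval j D.1) (𝒯.eval j D'.1) := by
  have hj4 : j ^ (3 + 1) = 1 := by linear_combination (j * j - 1) * hj
  refine h.of_step (r := fun D D' => EqUpToPow j (𝒯.eval j D.1) (𝒯.eval j D'.1))
    ((EqUpToPow.equivalence hj4).comap _) ?_
  rintro D D' ⟨u, a, b, v, hab, hD, hD'⟩
  have heval : EqUpToPow j (𝒯.eval j a) (𝒯.eval j b) :=
    hab.elim (𝒯.eqUpToPow_of_isotopyMove hj) fun h => .of_eq j (𝒯.eval_eq_of_fiveMove h5 h)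
  rw [hD, hD']
  simp only [eval_append]
  exact ((EqUpToPow.of_eq j rfl).mul heval).mul (.of_eq j rfl)

variable (j) in
/-- The value of the rational tangle `[p/q]`. -/
def fractionValue (p q : ℤ) : A := (q : R) • 1 + (j * p) • 𝒯.cupCap

theorem eval_integerTangle (a : ℤ) : 𝒯.eval j (integerTangle a).1 = 𝒯.crossing (a * j) := by
  simp only [eval, integerTangle, List.map_replicate, List.prod_replicate, pow_zero,
    AlgHom.one_apply]
  split_ifs with ha
  · rw [pieceValue, crossing_pow, ← Int.cast_natCast, Int.natAbs_of_nonneg ha]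
  · rw [pieceValue, crossing_pow, ← Int.cast_natCast, Int.ofNat_natAbs_of_nonpos (by omega),
      Int.cast_neg, neg_mul_neg]

theorem eval_rotation (T : TwoTangle) : 𝒯.eval j (rotation T).1 =
    𝒯.shift (𝒯.shift 𝒯.birth * 𝒯.eval j T.1) * 𝒯.death := by
  change 𝒯.eval j ((.birth, 2) :: (shiftWord 1 T.1 ++ [(.death, 0)])) = _
  simp only [eval_cons, eval_append, eval_shiftWord, eval_nil, pieceValue, pow_succ, pow_zero,
    one_mul, mul_one, AlgHom.mul_apply, AlgHom.one_apply, map_mul, mul_assoc]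

theorem fractionValue_mul_crossing (p q a : ℤ) :
    𝒯.fractionValue j p q * 𝒯.crossing (a * j) = 𝒯.fractionValue j (p + a * q) q := by
  simp only [fractionValue, crossing, add_mul, mul_add, mul_one, smul_mul_smul_comm, one_mul,
    cupCap_mul_cupCap, Int.cast_add, Int.cast_mul]
  module

theorem shift_birth_mul_fractionValue_mul_death (hj : j * j = -1) (p q : ℤ) :
    𝒯.shift (𝒯.shift 𝒯.birth * 𝒯.fractionValue j p q) * 𝒯.death =
      j • 𝒯.fractionValue j (-q) p := by
  have h : 𝒯.shift (𝒯.shift 𝒯.birth) * 𝒯.death = 𝒯.cupCap := (𝒯.death_mul _).symm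
  simp only [fractionValue, mul_add, mul_smul_comm, mul_one, shift_birth_mul_cupCap, map_add,
    map_smul, add_mul, smul_mul_assoc, h, shift_birth_mul_death, Int.cast_neg]
  match_scalars
  · linear_combination (q : R) * hj
  · ring

theorem eqUpToPow_eval_conway (hj : j * j = -1) (l : List ℤ) :
    EqUpToPow j (𝒯.eval j (conway l).1) (𝒯.fractionValue j (fraction l).1 (fraction l).2) := by
  have hj4 : j ^ (3 + 1) = 1 := by linear_combination (j * j - 1) * hj
  have hequiv := EqUpToPow.equivalence (M := A) hj4
  refine conway_induction
    (P := fun p q T => EqUpToPow j (𝒯.eval j T.1) (𝒯.fractionValue j p q)) ?_ ?_ ?_ ?_ l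
  · refine hequiv.symm ⟨1, ?_⟩
    simp [fractionValue, infinityTangle, eval_cons, eval_nil, pieceValue, cupCap]
  · intro p q T h
    refine hequiv.trans h ⟨2, ?_⟩
    rw [pow_two, hj]
    simp only [fractionValue, Int.cast_neg]
    module
  · intro p q T h
    rw [eval_rotation]
    have h' := ((((EqUpToPow.of_eq j (rfl : 𝒯.shift 𝒯.birth = _)).mul h).map 𝒯.shift).mul
      (.of_eq j (rfl : 𝒯.death = _)))
    rw [shift_birth_mul_fractionValue_mul_death 𝒯 hj] at h'
    exact hequiv.trans h' (.smul_self j _)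
  · intro p q T a h
    rw [← 𝒯.fractionValue_mul_crossing, ← eval_integerTangle, FiveMoves.add, eval_append]
    exact h.mul (.of_eq j rfl)

theorem smul_one_add_smul_cupCap_injective (hA : Function.Injective (algebraMap R A))
    {a b a' b' : R} (h : a • 1 + b • 𝒯.cupCap = a' • 1 + b' • 𝒯.cupCap) : a = a' ∧ b = b' := by
  have hone {r r' : R} (h : r • (1 : A) = r' • 1) : r = r' :=
    hA (by simpa only [Algebra.algebraMap_eq_smul_one] using h)
  have hclose (a b : R) :
      𝒯.shift 𝒯.birth * (a • 1 + b • 𝒯.cupCap) * 𝒯.shift 𝒯.death = b • 1 := by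
    simp only [mul_add, add_mul, mul_smul_comm, smul_mul_assoc, mul_one, shift_birth_mul_cupCap,
      ← map_mul, birth_mul_death, birth_mul_shift_death, map_zero, smul_zero, zero_add]
  obtain rfl : b = b' := hone (by rw [← hclose a, h, hclose])
  exact ⟨hone (add_right_cancel h), rfl⟩

theorem exists_eq_pow_mul_of_fiveMoveEquiv_conway (𝒯 : TangleAlgebra R A)
    (hA : Function.Injective (algebraMap R A)) (hj : j * j = -1) (h5 : (5 : R) = 0) {l l' : List ℤ}
    (h : FiveMoveEquiv (conway l) (conway l')) :
    ∃ k : ℕ, ((fraction l).1 : R) = j ^ k * (fraction l').1 ∧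
      ((fraction l).2 : R) = j ^ k * (fraction l').2 := by
  have hj4 : j ^ (3 + 1) = 1 := by linear_combination (j * j - 1) * hj
  have hequiv := EqUpToPow.equivalence (M := A) hj4
  obtain ⟨k, hk⟩ := hequiv.trans (hequiv.symm (𝒯.eqUpToPow_eval_conway hj l))
    (hequiv.trans (𝒯.eqUpToPow_of_fiveMoveEquiv hj h5 h) (𝒯.eqUpToPow_eval_conway hj l'))
  simp only [fractionValue, smul_add, smul_smul] at hk
  obtain ⟨hq, hp⟩ := 𝒯.smul_one_add_smul_cupCap_injective hA hk
  exact ⟨k, by linear_combination -j * hp + ((fraction l).1 - j ^ k * (fraction l').1) * hj, hq⟩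

end TangleAlgebra

theorem algebraMap_end_pi_injective {R ι : Type*} [CommRing R] [Nonempty ι] :
    Function.Injective (algebraMap R (Module.End R (ι → R))) := fun _ _ h => by
  simpa using congrFun (LinearMap.congr_fun h 1) (Classical.arbitrary ι)

section StreamModel

open scoped Stream'

variable {R : Type*} [CommRing R]

/-- The action of an operator on the labels of the strands below the first one. -/
def streamShift : Module.End R (Stream' Bool → R) →ₐ[R] Module.End R (Stream' Bool → R) where
  toFun F :=
    { toFun f s := F (fun t => f (s.head :: t)) s.tail
      map_add' _ _ := funext fun _ => congrFun (F.map_add _ _) _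
      map_smul' _ _ := funext fun _ => congrFun (F.map_smul _ _) _ }
  map_one' := by ext; simp
  map_mul' _ _ := by ext; simp
  map_zero' := by ext; simp
  map_add' _ _ := by ext; simp
  commutes' _ := by ext; simp

theorem streamShift_apply (F : Module.End R (Stream' Bool → R)) (f : Stream' Bool → R)
    (s : Stream' Bool) : streamShift F f s = F (fun t => f (s.head :: t)) s.tail := rfl

/-- The operator of a left turning point `⊂`: its two ends carry distinct labels. -/
def streamBirth (j : R) : Module.End R (Stream' Bool → R) where
  toFun f s := f (true :: false :: s) - j * f (false :: true :: s)
  map_add' _ _ := by ext; simp; ring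
  map_smul' _ _ := by ext; simp; ring

theorem streamBirth_apply (j : R) (f : Stream' Bool → R) (s : Stream' Bool) :
    streamBirth j f s = f (true :: false :: s) - j * f (false :: true :: s) := rfl

/-- The weight of a right turning point `⊃` whose ends carry the labels `a` and `b`. -/
def deathWeight (j : R) (a b : Bool) : R :=
  if a = b then 0 else if a then j else 1

/-- The operator of a right turning point `⊃`. -/
def streamDeath (j : R) : Module.End R (Stream' Bool → R) where
  toFun f s := deathWeight j s.head s.tail.head * f s.tail.tail
  map_add' _ _ := by ext; simp; ring
  map_smul' _ _ := by ext; simp; ring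

theorem streamDeath_apply (j : R) (f : Stream' Bool → R) (s : Stream' Bool) :
    streamDeath j f s = deathWeight j s.head s.tail.head * f s.tail.tail := rfl

/-- Diagrams act on functions of the labels of the strands, which are infinite in number; only
the first few of them take part in a diagram. -/
def streamAlgebra {j : R} (hj : j * j = -1) :
    TangleAlgebra R (Module.End R (Stream' Bool → R)) where
  shift := streamShift
  birth := streamBirth j
  death := streamDeath j
  birth_mul_shift_shift F := by
    ext f s
    have h : streamBirth j f =
      (fun t => f (true :: false :: t)) - j • fun t => f (false :: true :: t) := rfl
    simp only [Module.End.mul_apply, h, map_sub, map_smul]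
    rfl
  death_mul F := by
    ext f s
    have h : (fun t => streamDeath j f (s.head :: s.tail.head :: t)) =
      deathWeight j s.head s.tail.head • f := rfl
    simp only [Module.End.mul_apply, streamShift_apply, h, map_smul]
    rfl
  birth_mul_death := by
    ext f s
    simp [streamBirth_apply, streamDeath_apply, deathWeight]
  birth_mul_shift_death := by
    ext f s
    rw [← Stream'.eta s]
    cases s.head <;>
      simp [streamBirth_apply, streamDeath_apply, streamShift_apply, deathWeight, ← mul_assoc, hj]
  shift_birth_mul_death := by
    ext f s
    rw [← Stream'.eta s]
    cases s.head <;>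
      simp [streamBirth_apply, streamDeath_apply, streamShift_apply, deathWeight, ← mul_assoc, hj]

end StreamModel

theorem modEqUpToSign_of_fiveMoveEquiv_conway {l l' : List ℤ}
    (h : FiveMoveEquiv (conway l) (conway l')) :
    ModEqUpToSign 5 (fraction l) (fraction l') := by
  -- Two square roots of `-1` are needed to exclude multiplication of the fraction by `2`.
  let j : ZMod 5 × ZMod 5 := (2, 3)
  have hj : j * j = -1 := by decide
  obtain ⟨k, hp, hq⟩ := (streamAlgebra hj).exists_eq_pow_mul_of_fiveMoveEquiv_conway
    algebraMap_end_pi_injective hj (by decide) h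
  obtain ⟨hp₂, hp₃⟩ := Prod.ext_iff.1 hp
  obtain ⟨hq₂, hq₃⟩ := Prod.ext_iff.1 hq
  simp only [Prod.fst_intCast, Prod.snd_intCast, Prod.fst_mul, Prod.snd_mul, Prod.pow_fst,
    Prod.pow_snd, j] at hp₂ hp₃ hq₂ hq₃
  obtain ⟨a, b, hab⟩ := isCoprime_fraction l'
  replace hab : (a * (fraction l').1 + b * (fraction l').2 : ZMod 5) = 1 := mod_cast congrArg _ hab
  have h23 : (2 : ZMod 5) ^ k = 3 ^ k := by
    linear_combination (3 ^ k - 2 ^ k) * hab - a * hp₂ + a * hp₃ - b * hq₂ + b * hq₃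
  have hsq : (2 : ZMod 5) ^ k * 2 ^ k = 1 := by
    nth_rw 2 [h23]
    rw [← mul_pow, show (2 * 3 : ZMod 5) = 1 by decide, one_pow]
  have hsign : (2 : ZMod 5) ^ k = 1 ∨ (2 : ZMod 5) ^ k = -1 := by
    generalize (2 : ZMod 5) ^ k = u at hsq
    decide +revert
  simp only [ModEqUpToSign, ← Nat.cast_ofNat (R := ℤ) (n := 5), ← ZMod.intCast_eq_intCast_iff,
    Int.cast_neg, hp₂, hq₂]
  exact hsign.imp (fun h => by simp [h]) fun h => by simp [h]

/-! ### Orbits of braid groups -/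

section BraidOrbits

variable {G X : Type*} [Group G] [MulAction G X]

theorem orbit_closure_induction {S : Set G} (hS : ∀ g ∈ S, IsOfFinOrder g) {e : X} {p : X → Prop}
    (base : p e) (step : ∀ g ∈ S, ∀ x, p x → p (g • x)) :
    ∀ x ∈ MulAction.orbit (Subgroup.closure S) e, p x := by
  rintro _ ⟨⟨g, hg⟩, rfl⟩
  change p (g • e)
  replace hg : g ∈ Submonoid.closure S :=
    Subgroup.closure_toSubmonoid_of_isOfFinOrder hS ▸ (Subgroup.mem_toSubmonoid _ _).2 hg
  induction hg using Submonoid.closure_induction_left with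
  | one => rwa [one_smul]
  | mul_left k hk h _ ih => rw [mul_smul]; exact step k hk _ ih

variable {r s t : G} {e : X}

theorem pow_eq_one_of_braid {n : ℕ} (hst : s * t * s = t * s * t) (hs : s ^ n = 1) :
    t ^ n = 1 := by
  have h : t = s * t * s * (s * t)⁻¹ := by rw [hst, mul_assoc t, mul_inv_cancel_right]
  rw [h, conj_pow, hs, mul_one, mul_inv_cancel]

theorem braid_smul (hst : s * t * s = t * s * t) (x : X) : s • t • s • x = t • s • t • x := by
  simp only [← mul_smul, ← mul_assoc, hst]

theorem smul_five (hs : s ^ 5 = 1) (x : X) : s • s • s • s • s • x = x := by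
  simpa only [pow_succ', pow_zero, mul_smul, one_smul] using congrArg (· • x) hs

theorem smul_eq_smul_of_mem_orbit (hs : IsOfFinOrder s) (ht : IsOfFinOrder t) (hrt : r * t = t * r)
    (hst : s * t * s = t * s * t) (hsr : s * r * s = r * s * r) (he : r • e = t • e)
    (he' : r • s • e = t • s • e) :
    ∀ x ∈ MulAction.orbit (Subgroup.closure {s, t}) e, r • x = t • x := by
  have hrt' (x : X) : r • t • x = t • r • x := by simp only [smul_smul, hrt]
  suffices H : ∀ x ∈ MulAction.orbit (Subgroup.closure {s, t}) e,
      r • x = t • x ∧ r • s • x = t • s • x from fun x hx => (H x hx).1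
  refine orbit_closure_induction (by simp [hs, ht]) ⟨he, he'⟩ ?_
  rintro g (rfl | rfl) x ⟨h, h'⟩
  · refine ⟨h', MulAction.injective g ?_⟩
    have h₁ : r • g • t • x = t • g • t • x := by
      rw [← braid_smul hst, ← h', braid_smul hsr, h]
    change g • r • g • g • x = g • t • g • g • x
    rw [braid_smul hsr, h', braid_smul hst, hrt', h₁, ← braid_smul hst, ← braid_smul hst]
  · exact ⟨by rw [hrt', h], by rw [← h, ← braid_smul hsr, h', h, ← braid_smul hst, ← h']⟩

/-- The `i`-th point of the `k`-th circle around `e`. If `s` and `t` generate a braid group on three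
strands and have order five, `t` fixes `e`, and so does `s * t * t * s`, then the points `e`,
`circlePoint s t e 1 i`, `circlePoint s t e 2 i` and one more are permuted by `s` and `t` like the
vertices of an icosahedron by rotations about adjacent vertices. -/
def circlePoint (s t : G) (e : X) (k i : ℕ) : X := t ^ i • s ^ k • e

theorem smul_circlePoint (s t : G) (e : X) (k i : ℕ) :
    t • circlePoint s t e k i = circlePoint s t e k (i + 1) := by
  rw [circlePoint, circlePoint, pow_succ', mul_smul]

theorem circlePoint_five (ht : t ^ 5 = 1) (s : G) (e : X) (k : ℕ) :
    circlePoint s t e k 5 = circlePoint s t e k 0 := by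
  rw [circlePoint, circlePoint, ht, pow_zero]

theorem smul_circlePoint_near (hs : s ^ 5 = 1) (hst : s * t * s = t * s * t) (he : t • e = e)
    (he' : (s * t * t * s) • e = e) :
    s • e = circlePoint s t e 1 0 ∧ s • circlePoint s t e 1 0 = circlePoint s t e 2 0 ∧
    s • circlePoint s t e 2 0 = circlePoint s t e 2 1 ∧
    s • circlePoint s t e 2 1 = circlePoint s t e 1 2 ∧ s • circlePoint s t e 1 2 = e ∧
    s • circlePoint s t e 1 1 = circlePoint s t e 1 1 := by
  have se : s • e = circlePoint s t e 1 0 := by rw [circlePoint, pow_zero, one_smul, pow_one]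
  have sa₀ : s • circlePoint s t e 1 0 = circlePoint s t e 2 0 := by
    simp only [circlePoint, pow_zero, one_smul, pow_succ', mul_smul]
  have sa₁ : s • circlePoint s t e 1 1 = circlePoint s t e 1 1 := by
    rw [← smul_circlePoint, ← se, braid_smul hst, he]
  have sa₂ : s • circlePoint s t e 1 2 = e := by
    simpa only [circlePoint, pow_one, pow_two, smul_smul, mul_assoc] using he'
  have sb₁ : s • circlePoint s t e 2 1 = circlePoint s t e 1 2 := by
    rw [← smul_circlePoint, ← sa₀, braid_smul hst, smul_circlePoint, sa₁, smul_circlePoint]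
  have sb₀ : s • circlePoint s t e 2 0 = circlePoint s t e 2 1 := by
    rw [← smul_left_cancel_iff s, ← smul_left_cancel_iff s, sb₁, sa₂, ← sa₀, ← se, smul_five hs]
  exact ⟨se, sa₀, sb₀, sb₁, sa₂, sa₁⟩

theorem smul_circlePoint_far (hs : s ^ 5 = 1) (hst : s * t * s = t * s * t) (he : t • e = e)
    (he' : (s * t * t * s) • e = e) :
    s • circlePoint s t e 1 3 = circlePoint s t e 1 4 ∧
    s • circlePoint s t e 1 4 = circlePoint s t e 2 4 ∧
    s • s • circlePoint s t e 2 4 = circlePoint s t e 2 2 ∧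
    s • circlePoint s t e 2 2 = circlePoint s t e 1 3 ∧
    s • circlePoint s t e 2 3 = circlePoint s t e 2 3 ∧
    t • s • circlePoint s t e 2 4 = s • circlePoint s t e 2 4 := by
  obtain ⟨se, sa₀, sb₀, sb₁, sa₂, -⟩ := smul_circlePoint_near hs hst he he'
  have ht := pow_eq_one_of_braid hst hs
  have ta (i : ℕ) := smul_circlePoint s t e 1 i
  have tb (i : ℕ) := smul_circlePoint s t e 2 i
  have ta₄ := (ta 4).trans (circlePoint_five ht s e 1)
  have tb₄ := (tb 4).trans (circlePoint_five ht s e 2)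
  have sa₃ : s • circlePoint s t e 1 3 = circlePoint s t e 1 4 := by
    rw [← smul_left_cancel_iff t, ← ta, ← braid_smul hst, sa₂, he, se, ta₄]
  have sa₄ : s • circlePoint s t e 1 4 = circlePoint s t e 2 4 := by
    rw [← smul_left_cancel_iff t, ← smul_left_cancel_iff s, braid_smul hst, ta₄, tb₄, sa₀, sb₀, tb]
  have sb₂ : s • circlePoint s t e 2 2 = circlePoint s t e 1 3 := by
    rw [← smul_left_cancel_iff t, ← tb, ← braid_smul hst, sb₁, ta, ta, sa₃]
  have sb₃ : s • circlePoint s t e 2 3 = circlePoint s t e 2 3 := by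
    rw [← smul_left_cancel_iff t, ← tb, ← braid_smul hst, sb₂, ta, sa₄, tb, tb]
  have sf : s • s • circlePoint s t e 2 4 = circlePoint s t e 2 2 := by
    rw [← sa₄, ← sa₃, ← sb₂, smul_five hs]
  exact ⟨sa₃, sa₄, sf, sb₂, sb₃, by rw [← tb, ← braid_smul hst, sb₃]⟩

theorem encard_orbit_closure_le_twelve (hs : s ^ 5 = 1) (hst : s * t * s = t * s * t)
    (he : t • e = e) (he' : (s * t * t * s) • e = e) :
    (MulAction.orbit (Subgroup.closure {s, t}) e).encard ≤ 12 := by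
  obtain ⟨se, sa₀, sb₀, sb₁, sa₂, sa₁⟩ := smul_circlePoint_near hs hst he he'
  obtain ⟨sa₃, sa₄, sf, sb₂, sb₃, tf⟩ := smul_circlePoint_far hs hst he he'
  have ht := pow_eq_one_of_braid hst hs
  have hS : ∀ g ∈ ({s, t} : Set G), IsOfFinOrder g := by
    simpa using ⟨isOfFinOrder_iff_pow_eq_one.2 ⟨5, by simp, hs⟩,
      isOfFinOrder_iff_pow_eq_one.2 ⟨5, by simp, ht⟩⟩
  have ta (i : ℕ) := smul_circlePoint s t e 1 i
  have tb (i : ℕ) := smul_circlePoint s t e 2 i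
  have ta₄ := (ta 4).trans (circlePoint_five ht s e 1)
  have tb₄ := (tb 4).trans (circlePoint_five ht s e 2)
  set a := circlePoint s t e 1
  set b := circlePoint s t e 2
  let P : Fin 12 → X := ![e, a 0, a 1, a 2, a 3, a 4, b 0, b 1, b 2, b 3, b 4, s • b 4]
  have hP : MulAction.orbit (Subgroup.closure {s, t}) e ⊆ P '' Set.univ := by
    refine orbit_closure_induction hS ⟨0, trivial, rfl⟩ ?_
    rintro g (rfl | rfl) x ⟨k, -, rfl⟩
    · fin_cases k
      exacts [⟨1, trivial, se.symm⟩, ⟨6, trivial, sa₀.symm⟩, ⟨2, trivial, sa₁.symm⟩,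
        ⟨0, trivial, sa₂.symm⟩, ⟨5, trivial, sa₃.symm⟩, ⟨10, trivial, sa₄.symm⟩,
        ⟨7, trivial, sb₀.symm⟩, ⟨3, trivial, sb₁.symm⟩, ⟨4, trivial, sb₂.symm⟩,
        ⟨9, trivial, sb₃.symm⟩, ⟨11, trivial, rfl⟩, ⟨8, trivial, sf.symm⟩]
    · fin_cases k
      exacts [⟨0, trivial, he.symm⟩, ⟨2, trivial, (ta 0).symm⟩, ⟨3, trivial, (ta 1).symm⟩,
        ⟨4, trivial, (ta 2).symm⟩, ⟨5, trivial, (ta 3).symm⟩, ⟨1, trivial, ta₄.symm⟩,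
        ⟨7, trivial, (tb 0).symm⟩, ⟨8, trivial, (tb 1).symm⟩, ⟨9, trivial, (tb 2).symm⟩,
        ⟨10, trivial, (tb 3).symm⟩, ⟨6, trivial, tb₄.symm⟩, ⟨11, trivial, tf.symm⟩]
  exact (Set.encard_le_encard hP).trans ((Set.encard_image_le _ _).trans (by simp))

end BraidOrbits

/-! ### Words up to 5-move equivalence -/

open Piece

instance decidableRuns : ∀ (w : Word) (m n : ℕ), Decidable (Runs w m n)
  | [], m, n => decEq m n
  | (e, i) :: w, m, n =>
    haveI := decidableRuns w (m - e.ins + e.outs) n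
    inferInstanceAs (Decidable (i + e.ins ≤ m ∧ Runs w (m - e.ins + e.outs) n))

theorem shiftWord_zero (w : Word) : shiftWord 0 w = w := by simp [shiftWord]

theorem shiftWord_shiftWord (s t : ℕ) (w : Word) :
    shiftWord s (shiftWord t w) = shiftWord (s + t) w := by
  simp [shiftWord, Function.comp_def, add_assoc]

theorem LocalMove.shiftWord (s : ℕ) {a b : Word} (h : LocalMove a b) :
    LocalMove (shiftWord s a) (shiftWord s b) := by
  rcases h with h | h
  · left
    cases h with
    | far e f i k => simpa [FiveMoves.shiftWord, add_assoc] using IsotopyMove.far e f (s + i) k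
    | _ => constructor
  · right
    cases h <;> constructor

/-- 5-move equivalence of words, including that they are diagrams with `m` end points on the left
and `n` on the right. -/
def WordEquiv (m n : ℕ) (w w' : Word) : Prop :=
  ∃ (h : Runs w m n) (h' : Runs w' m n), FiveMoveEquiv (⟨w, h⟩ : Diagram m n) ⟨w', h'⟩

theorem fiveMoveEquiv_equivalence (m n : ℕ) :
    Equivalence (FiveMoveEquiv : Diagram m n → Diagram m n → Prop) :=
  Relation.EqvGen.is_equivalence _

namespace WordEquiv

variable {k l m n : ℕ} {u v w w' w'' : Word}

theorem of_eq (h : w = w') (hw : Runs w' m n) : WordEquiv m n w w' := by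
  subst h
  exact ⟨hw, hw, .refl _⟩

theorem symm (h : WordEquiv m n w w') : WordEquiv m n w' w := ⟨h.2.1, h.1, .symm _ _ h.2.2⟩

theorem trans (h : WordEquiv m n w w') (h' : WordEquiv m n w' w'') : WordEquiv m n w w'' :=
  ⟨h.1, h'.2.1, .trans _ _ _ h.2.2 h'.2.2⟩

instance : Trans (WordEquiv m n) (WordEquiv m n) (WordEquiv m n) := ⟨trans⟩

theorem step (u v : Word) {a b : Word} (hab : IsotopyMove a b)
    (h : Runs (u ++ a ++ v) m n := by decide) (h' : Runs (u ++ b ++ v) m n := by decide) :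
    WordEquiv m n (u ++ a ++ v) (u ++ b ++ v) :=
  ⟨h, h', .rel _ _ (.inl ⟨u, a, b, v, hab, rfl, rfl⟩)⟩

theorem of_fiveMove (h : FiveMove w w') (hw : Runs w m n) (hw' : Runs w' m n) :
    WordEquiv m n w w' :=
  ⟨hw, hw', .rel _ _ (.inr ⟨[], w, w', [], h, by simp, by simp⟩)⟩

theorem context (s t : ℕ) (hu : Runs u k (s + m + t)) (hv : Runs v (s + n + t) l)
    (h : WordEquiv m n w w') :
    WordEquiv k l (u ++ shiftWord s w ++ v) (u ++ shiftWord s w' ++ v) := by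
  obtain ⟨hw, hw', h⟩ := h
  let C (D : Diagram m n) : Diagram k l :=
    ⟨u ++ shiftWord s D.1 ++ v, runs_append (runs_append hu (runs_shift s t D.2)) hv⟩
  refine ⟨(C ⟨w, hw⟩).2, (C ⟨w', hw'⟩).2, h.of_step (r := fun D D' => FiveMoveEquiv (C D) (C D'))
    ((fiveMoveEquiv_equivalence k l).comap C) ?_⟩
  rintro D D' ⟨x, a, b, y, hab, hD, hD'⟩
  rw [fiveMoveEquiv_eq]
  exact .rel _ _ ⟨u ++ shiftWord s x, _, _, shiftWord s y ++ v, hab.shiftWord s,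
    by simp [C, hD, shiftWord_append], by simp [C, hD', shiftWord_append]⟩

theorem shift (s t : ℕ) (h : WordEquiv m n w w') :
    WordEquiv (s + m + t) (s + n + t) (shiftWord s w) (shiftWord s w') := by
  simpa using h.context (u := []) (v := []) s t rfl rfl

theorem append_left (h : WordEquiv m n w w') (hu : Runs u k m := by decide) :
    WordEquiv k n (u ++ w) (u ++ w') := by
  simpa [shiftWord_zero] using h.context (u := u) (v := []) 0 0 (by simpa using hu) rfl

theorem append_right (h : WordEquiv m n w w') (hv : Runs v n l := by decide) :
    WordEquiv m l (w ++ v) (w' ++ v) := by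
  simpa [shiftWord_zero] using h.context (u := []) (v := v) 0 0 rfl (by simpa using hv)

theorem cons_shiftWord (e : Piece) {a b : ℕ} (h : Runs w a b) :
    WordEquiv (e.ins + a) (e.outs + b)
      ((e, 0) :: shiftWord e.outs w) (shiftWord e.ins w ++ [(e, 0)]) := by
  have he (a : ℕ) : Runs [(e, 0)] (e.ins + a) (e.outs + a) := ⟨by omega, by change _ = _; omega⟩
  induction w generalizing a with
  | nil => cases h; exact of_eq rfl (he _)
  | cons x w ih =>
    obtain ⟨f, i⟩ := x
    obtain ⟨hi : i + f.ins ≤ a, hw⟩ := h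
    have hf (s : ℕ) : Runs [(f, s + i)] (s + a) (s + (a - f.ins + f.outs)) :=
      ⟨by omega, by change _ = _; omega⟩
    have hfar : WordEquiv (e.ins + a) (e.outs + (a - f.ins + f.outs))
        [(e, 0), (f, e.outs + i)] [(f, e.ins + i), (e, 0)] := by
      simpa using step [] [] (.far e f 0 i) (by simpa using runs_append (he a) (hf _))
        (by simpa using runs_append (hf _) (he _))
    exact (hfar.append_right (v := shiftWord e.outs w)
      (runs_shift e.outs 0 hw)).trans
      ((ih hw).append_left (hf _))

theorem far_word (e : Piece) (i k c : ℕ) {a b : ℕ} (h : Runs w a b) :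
    WordEquiv (i + e.ins + k + a + c) (i + e.outs + k + b + c)
      ((e, i) :: shiftWord (i + e.outs + k) w) (shiftWord (i + e.ins + k) w ++ [(e, i)]) := by
  simpa [shiftWord_cons, shiftWord_append, shiftWord_shiftWord, shiftWord_nil, add_assoc] using
    (cons_shiftWord e (runs_shift k c h)).shift i 0

end WordEquiv

/-! ### Half-twists -/

/-- Diagrams with `m` end points on the left and `n` on the right, up to 5-move equivalence. -/
def TangleClass (m n : ℕ) : Type :=
  Quotient (⟨FiveMoveEquiv, fiveMoveEquiv_equivalence m n⟩ : Setoid (Diagram m n))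

namespace TangleClass

variable {k l m n : ℕ} {u v v' w w' : Word}

/-- The 5-move equivalence class of a word. -/
def mk (w : Word) (h : Runs w m n := by decide) : TangleClass m n := Quotient.mk _ ⟨w, h⟩

theorem ind {p : TangleClass m n → Prop} (h : ∀ w hw, p (mk w hw)) (x : TangleClass m n) : p x :=
  Quotient.ind (fun D => h D.1 D.2) x

theorem sound (h : WordEquiv m n w w') : mk w h.1 = mk w' h.2.1 := Quotient.sound h.2.2

theorem exact {h : Runs w m n} {h' : Runs w' m n} (H : mk w h = mk w' h') :
    WordEquiv m n w w' :=
  ⟨h, h', Quotient.exact H⟩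

/-- Append a diagram on the right. -/
def append (v : Word) (hv : Runs v n l) : TangleClass m n → TangleClass m l :=
  Quotient.map (fun D => ⟨D.1 ++ v, runs_append D.2 hv⟩)
    fun D D' h => (WordEquiv.append_right ⟨D.2, D'.2, h⟩ hv).2.2

theorem append_congr (h : WordEquiv n l v v') (x : TangleClass m n) :
    append v h.1 x = append v' h.2.1 x := by
  induction x using ind with | h w hw => exact sound (h.append_left hw)

theorem append_append (hv : Runs v n k) (hv' : Runs v' k l) (x : TangleClass m n) :
    append v' hv' (append v hv x) = append (v ++ v') (runs_append hv hv') x := by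
  induction x using ind with
  | h w hw => exact sound (.of_eq (List.append_assoc ..) (runs_append hw (runs_append hv hv')))

theorem append_nil (x : TangleClass m n) : append [] rfl x = x := by
  induction x using ind with
  | h w hw => exact sound (.of_eq (List.append_nil w) hw)

end TangleClass

open TangleClass

theorem runs_pos {i : ℕ} (hi : i + 2 ≤ 4) : Runs [(pos, i)] 4 4 := ⟨hi, rfl⟩

theorem runs_neg {i : ℕ} (hi : i + 2 ≤ 4) : Runs [(neg, i)] 4 4 := ⟨hi, rfl⟩

/-- The half-twist of the strands `i` and `i + 1` at the right end of a tangle with four end points,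
all of them on the right. -/
def twist (i : ℕ) (hi : i + 2 ≤ 4 := by decide) : Equiv.Perm (TangleClass 0 4) where
  toFun := append [(pos, i)] (runs_pos hi)
  invFun := append [(neg, i)] (runs_neg hi)
  left_inv x := by
    rw [append_append]
    exact (append_congr (.step [] [] (.cancel₁ i) ⟨hi, hi, rfl⟩ rfl) x).trans (append_nil x)
  right_inv x := by
    rw [append_append]
    exact (append_congr (.step [] [] (.cancel₂ i) ⟨hi, hi, rfl⟩ rfl) x).trans (append_nil x)

theorem twist_apply (i : ℕ) (hi : i + 2 ≤ 4) (x : TangleClass 0 4) :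
    twist i hi x = append [(pos, i)] (runs_pos hi) x := rfl

theorem twist_pow_five (i : ℕ) (hi : i + 2 ≤ 4) : twist i hi ^ 5 = 1 := by
  ext x
  simp only [pow_succ, pow_zero, one_mul, Equiv.Perm.mul_apply, twist_apply, append_append]
  exact (append_congr (.symm (.of_fiveMove (.plus i) rfl ⟨hi, hi, hi, hi, hi, rfl⟩)) x).trans
    (append_nil x)

theorem isOfFinOrder_twist (i : ℕ) (hi : i + 2 ≤ 4) : IsOfFinOrder (twist i hi) :=
  isOfFinOrder_iff_pow_eq_one.2 ⟨5, by decide, twist_pow_five i hi⟩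

theorem twist_braid (i : ℕ) (hi : i + 3 ≤ 4) :
    twist i (by omega) * twist (i + 1) hi * twist i (by omega) =
      twist (i + 1) hi * twist i (by omega) * twist (i + 1) hi := by
  ext x
  simp only [Equiv.Perm.mul_apply, twist_apply, append_append]
  have hi' : i + 2 ≤ 4 := by omega
  exact append_congr (.step [] [] (.braid i) ⟨hi', hi, hi', rfl⟩ ⟨hi, hi', hi, rfl⟩) x

theorem commute_twist_zero_twist_two : Commute (twist 0) (twist 2) := by
  ext x
  simp only [Equiv.Perm.mul_apply, twist_apply, append_append]
  exact append_congr (.symm (.step [] [] (.far pos pos 0 0))) x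

/-- The tangle in which strand `0` is joined to strand `1`, and strand `2` to strand `3`. -/
def pairs : TangleClass 0 4 := mk [(birth, 0), (birth, 2)]

/-- The tangle in which strand `0` is joined to strand `3`, and strand `1` to strand `2`. -/
def nested : TangleClass 0 4 := mk [(birth, 0), (birth, 1)]

theorem wordEquiv_pairs : WordEquiv 0 4 [(birth, 0), (birth, 2)] [(birth, 0), (birth, 0)] :=
  .step [] [] (.far birth birth 0 0)

theorem twist_two_pairs : twist 2 • pairs = pairs :=
  sound (.step [(birth, 0)] [] (.kink₁ 2))

theorem twist_zero_pairs : twist 0 • pairs = pairs :=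
  sound <| calc
    WordEquiv 0 4 _ [(birth, 0), (birth, 0), (pos, 0)] := wordEquiv_pairs.append_right
    WordEquiv 0 4 _ [(birth, 0), (birth, 0)] := .step [(birth, 0)] [] (.kink₁ 0)
    WordEquiv 0 4 _ _ := wordEquiv_pairs.symm

theorem twist_two_twist_one_pairs : twist 2 • twist 1 • pairs = nested :=
  sound <| calc
    WordEquiv 0 4 _ [(birth, 0), (birth, 1), (neg, 2), (pos, 2)] :=
      .symm (.step [(birth, 0)] [(pos, 2)] (.slide₂ 1))
    WordEquiv 0 4 _ _ := .step [(birth, 0), (birth, 1)] [] (.cancel₂ 2)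

theorem twist_zero_twist_one_pairs : twist 0 • twist 1 • pairs = nested :=
  sound <| calc
    WordEquiv 0 4 _ [(birth, 0), (birth, 0), (pos, 1), (pos, 0)] :=
      wordEquiv_pairs.append_right (v := [(pos, 1), (pos, 0)])
    WordEquiv 0 4 _ [(birth, 0), (birth, 1), (neg, 0), (pos, 0)] :=
      .step [(birth, 0)] [(pos, 0)] (.slide₁ 0)
    WordEquiv 0 4 _ _ := .step [(birth, 0), (birth, 1)] [] (.cancel₂ 0)

theorem twist_one_twist_two_nested : twist 1 • twist 2 • nested = pairs :=
  sound <| calc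
    WordEquiv 0 4 _ [(birth, 0), (birth, 2), (neg, 1), (pos, 1)] :=
      .step [(birth, 0)] [(pos, 1)] (.slide₁ 1)
    WordEquiv 0 4 _ _ := .step [(birth, 0), (birth, 2)] [] (.cancel₂ 1)

/-- The tangles obtained from `pairs` by twisting the last three of their four end points. -/
def twistOrbit : Set (TangleClass 0 4) :=
  MulAction.orbit (Subgroup.closure {twist 1, twist 2}) pairs

theorem pairs_mem_twistOrbit : pairs ∈ twistOrbit := MulAction.mem_orbit_self _

theorem smul_mem_twistOrbit {g : Equiv.Perm (TangleClass 0 4)}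
    (hg : g ∈ Subgroup.closure {twist 1, twist 2}) {x : TangleClass 0 4} (hx : x ∈ twistOrbit) :
    g • x ∈ twistOrbit :=
  MulAction.mem_orbit_of_mem_orbit (⟨g, hg⟩ : Subgroup.closure {twist 1, twist 2}) hx

theorem twist_one_mem_closure : twist 1 ∈ Subgroup.closure {twist 1, twist 2} :=
  Subgroup.subset_closure (.inl rfl)

theorem twist_two_mem_closure : twist 2 ∈ Subgroup.closure {twist 1, twist 2} :=
  Subgroup.subset_closure (.inr rfl)

theorem twistOrbit_induction {p : TangleClass 0 4 → Prop} (base : p pairs)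
    (one : ∀ x, p x → p (twist 1 • x)) (two : ∀ x, p x → p (twist 2 • x)) {x : TangleClass 0 4}
    (hx : x ∈ twistOrbit) : p x := by
  refine orbit_closure_induction ?_ base ?_ x hx
  · rintro g (rfl | rfl) <;> exact isOfFinOrder_twist ..
  · rintro g (rfl | rfl)
    exacts [one, two]

theorem nested_mem_twistOrbit : nested ∈ twistOrbit := by
  rw [← twist_two_twist_one_pairs]
  exact smul_mem_twistOrbit twist_two_mem_closure
    (smul_mem_twistOrbit twist_one_mem_closure pairs_mem_twistOrbit)

theorem encard_twistOrbit_le : twistOrbit.encard ≤ 12 :=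
  encard_orbit_closure_le_twelve (twist_pow_five 1 _) (twist_braid 1 le_rfl) twist_two_pairs <| by
    simp only [mul_smul]
    rw [twist_two_twist_one_pairs, twist_one_twist_two_nested]

theorem twist_zero_smul {x : TangleClass 0 4} (hx : x ∈ twistOrbit) :
    twist 0 • x = twist 2 • x :=
  smul_eq_smul_of_mem_orbit (isOfFinOrder_twist ..) (isOfFinOrder_twist ..)
    commute_twist_zero_twist_two.eq
    (twist_braid 1 le_rfl) (twist_braid 0 (by decide)).symm
    (twist_zero_pairs.trans twist_two_pairs.symm)
    (twist_zero_twist_one_pairs.trans twist_two_twist_one_pairs.symm) x hx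

/-! ### Bent tangles -/

/-- A cyclic rotation of the four end points: the strand `0` is pulled round to become the
strand `3`. -/
def rotate : TangleClass 0 4 → TangleClass 0 4 :=
  Quotient.map (fun D => ⟨[(birth, 0)] ++ shiftWord 1 D.1 ++ [(death, 0)],
      runs_append (runs_append ⟨le_rfl, rfl⟩ (runs_shift 1 1 D.2)) ⟨by decide, rfl⟩⟩)
    fun D D' h => (WordEquiv.context 1 1 (u := [(birth, 0)]) (v := [(death, 0)]) (by decide)
      (by decide) ⟨D.2, D'.2, h⟩).2.2

theorem rotate_twist_succ (i : ℕ) (hi : i + 3 ≤ 4) (x : TangleClass 0 4) :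
    rotate (twist (i + 1) hi x) = twist i (by omega) (rotate x) := by
  induction x using ind with
  | h w hw =>
    have hi' : i < 2 := by omega
    have hfar : WordEquiv 6 4 [(death, 0), (pos, i)] [(pos, i + 2), (death, 0)] := by
      rw [add_comm i]
      simpa [ins, outs] using WordEquiv.step [] [] (.far death pos 0 i) (m := 6) (n := 4)
        (by interval_cases i <;> decide) (by interval_cases i <;> decide)
    have hu : Runs ([(birth, 0)] ++ shiftWord 1 w) 0 6 :=
      runs_append ⟨le_rfl, rfl⟩ (runs_shift 1 1 hw)
    refine sound ?_
    calc
      WordEquiv 0 4 ([(birth, 0)] ++ shiftWord 1 (w ++ [(pos, i + 1)]) ++ [(death, 0)])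
          ([(birth, 0)] ++ shiftWord 1 w ++ [(pos, i + 2), (death, 0)]) :=
        .of_eq (by simp [shiftWord, add_comm 1, add_assoc]) (runs_append hu hfar.2.1)
      WordEquiv 0 4 _ ([(birth, 0)] ++ shiftWord 1 w ++ [(death, 0), (pos, i)]) :=
        hfar.symm.append_left hu
      WordEquiv 0 4 _ ([(birth, 0)] ++ shiftWord 1 w ++ [(death, 0)] ++ [(pos, i)]) :=
        .of_eq (by simp) (List.append_assoc .. ▸ runs_append hu hfar.1)

theorem rotate_pairs : rotate pairs = nested :=
  sound <| calc
    WordEquiv 0 4 [(birth, 0), (birth, 1), (birth, 3), (death, 0)]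
        [(birth, 0), (birth, 1), (death, 0), (birth, 1)] :=
      .symm (.step [(birth, 0), (birth, 1)] [] (.far death birth 0 1))
    WordEquiv 0 4 _ _ := .step [(birth, 0)] [(birth, 1)] (.zigzag₂ 0)

theorem rotate_mem_twistOrbit {x : TangleClass 0 4} (hx : x ∈ twistOrbit) :
    rotate x ∈ twistOrbit := by
  refine twistOrbit_induction (p := fun x => rotate x ∈ twistOrbit) ?_ (fun x h => ?_)
    (fun x h => ?_) hx
  · exact rotate_pairs ▸ nested_mem_twistOrbit
  · change rotate (twist (0 + 1) _ x) ∈ _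
    rw [rotate_twist_succ]
    change twist 0 • rotate x ∈ _
    rw [twist_zero_smul h]
    exact smul_mem_twistOrbit twist_two_mem_closure h
  · change rotate (twist (1 + 1) _ x) ∈ _
    rw [rotate_twist_succ]
    exact smul_mem_twistOrbit twist_one_mem_closure h

/-- The tangle obtained by bending the left end points of a tangle to the right, above it. -/
def bend (T : TwoTangle) : TangleClass 0 4 :=
  mk ([(birth, 0), (birth, 1)] ++ shiftWord 2 T.1) (runs_append (by decide) (runs_shift 2 0 T.2))

theorem bend_congr {T T' : TwoTangle} (h : FiveMoveEquiv T T') : bend T = bend T' :=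
  sound ((WordEquiv.shift 2 0 ⟨T.2, T'.2, h⟩).append_left (u := [(birth, 0), (birth, 1)]))

theorem bend_infinityTangle : bend infinityTangle = pairs :=
  sound (.step [(birth, 0)] [(birth, 2)] (.zigzag₁ 1))

theorem bend_rotation_eq_mk (T : TwoTangle) :
    bend (rotation T) = mk ([(birth, 0), (birth, 2)] ++ shiftWord 1 T.1)
      (runs_append (by decide) (runs_shift 1 1 T.2)) := by
  obtain ⟨w, hw⟩ := T
  have h₁ : Runs (shiftWord 1 w) 4 4 := runs_shift 1 1 hw
  have h₃ : Runs (shiftWord 3 w) 6 6 := runs_shift 3 1 hw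
  have hfar : WordEquiv 4 6 ((birth, 1) :: shiftWord 3 w) (shiftWord 1 w ++ [(birth, 1)]) :=
    .far_word birth 1 0 1 hw
  have hzigzag : WordEquiv 4 4 [(birth, 1), (death, 2)] [] := .step [] [] (.zigzag₁ 1)
  refine sound ?_
  calc
    WordEquiv 0 4 _ ([(birth, 0), (birth, 1), (birth, 4)] ++ (shiftWord 3 w ++ [(death, 2)])) :=
      .of_eq (by simp [rotation, shiftWord, Function.comp_def, ← add_assoc])
        (runs_append (by decide) (runs_append h₃ (by decide)))
    WordEquiv 0 4 _ ([(birth, 0), (birth, 2), (birth, 1)] ++ (shiftWord 3 w ++ [(death, 2)])) :=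
      .append_right (.step [(birth, 0)] [] (.far birth birth 1 1)) (runs_append h₃ (by decide))
    WordEquiv 0 4 _ ([(birth, 0), (birth, 2)] ++ (shiftWord 1 w ++ [(birth, 1)] ++ [(death, 2)])) :=
      (hfar.append_right (v := [(death, 2)])).append_left (u := [(birth, 0), (birth, 2)])
    WordEquiv 0 4 _ (([(birth, 0), (birth, 2)] ++ shiftWord 1 w) ++ [(birth, 1), (death, 2)]) :=
      .of_eq (by simp) (runs_append (runs_append (by decide) h₁) hzigzag.1)
    WordEquiv 0 4 _ (([(birth, 0), (birth, 2)] ++ shiftWord 1 w) ++ []) :=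
      hzigzag.append_left (runs_append (by decide) h₁)
    WordEquiv 0 4 _ ([(birth, 0), (birth, 2)] ++ shiftWord 1 w) :=
      .of_eq (List.append_nil _) (runs_append (by decide) h₁)

theorem rotate_bend_eq_mk (T : TwoTangle) :
    rotate (bend T) = mk ([(birth, 0), (birth, 0)] ++ shiftWord 1 T.1)
      (runs_append (by decide) (runs_shift 1 1 T.2)) := by
  obtain ⟨w, hw⟩ := T
  have h₁ : Runs (shiftWord 1 w) 4 4 := runs_shift 1 1 hw
  have h₃ : Runs (shiftWord 3 w) 6 6 := runs_shift 3 1 hw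
  have hfar : WordEquiv 6 4 ((death, 0) :: shiftWord 1 w) (shiftWord 3 w ++ [(death, 0)]) :=
    .far_word death 0 1 1 hw
  refine sound ?_
  calc
    WordEquiv 0 4 ([(birth, 0)] ++ shiftWord 1 ([(birth, 0), (birth, 1)] ++ shiftWord 2 w) ++
          [(death, 0)])
        ([(birth, 0), (birth, 1), (birth, 2)] ++ (shiftWord 3 w ++ [(death, 0)])) :=
      .of_eq (by simp [shiftWord, Function.comp_def, ← add_assoc])
        (runs_append (by decide) (runs_append h₃ (by decide)))
    WordEquiv 0 4 _ ([(birth, 0), (birth, 1), (birth, 2)] ++ ((death, 0) :: shiftWord 1 w)) :=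
      hfar.symm.append_left
    WordEquiv 0 4 _ ([(birth, 0), (birth, 1), (death, 0), (birth, 0)] ++ shiftWord 1 w) :=
      .append_right (.symm (.step [(birth, 0), (birth, 1)] [] (.far death birth 0 0))) h₁
    WordEquiv 0 4 _ ([(birth, 0), (birth, 0)] ++ shiftWord 1 w) :=
      .append_right (.step [(birth, 0)] [(birth, 0)] (.zigzag₂ 0)) h₁

theorem bend_rotation (T : TwoTangle) : bend (rotation T) = rotate (bend T) := by
  rw [bend_rotation_eq_mk, rotate_bend_eq_mk]
  exact sound (wordEquiv_pairs.append_right (runs_shift 1 1 T.2))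

theorem bend_add (T T' : TwoTangle) :
    bend (add T T') = append (shiftWord 2 T'.1) (runs_shift 2 0 T'.2) (bend T) :=
  sound (.of_eq (by simp [add, shiftWord]) (runs_append
    (runs_append (k := 4) (by decide) (runs_shift 2 0 T.2)) (runs_shift 2 0 T'.2)))

theorem append_replicate {m n : ℕ} {x : Piece × ℕ} (hx : Runs [x] n n) (k : ℕ)
    (h : Runs (List.replicate k x) n n) (y : TangleClass m n) :
    append _ h y = (append [x] hx)^[k] y := by
  induction k generalizing y with
  | zero => exact append_nil y
  | succ k ih =>
    have hx' : n - x.1.ins + x.1.outs = n := hx.2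
    have hk : Runs (List.replicate k x) (n - x.1.ins + x.1.outs) n := h.2
    rw [hx'] at hk
    rw [Function.iterate_succ_apply, ← ih hk, append_append]
    rfl

theorem bend_add_of_eq_replicate (T : TwoTangle) {T' : TwoTangle} {e : Piece} {k : ℕ}
    (he : Runs [(e, 2)] 4 4) (hT' : T'.1 = List.replicate k (e, 0)) :
    bend (add T T') = (append [(e, 2)] he)^[k] (bend T) := by
  have hk : shiftWord 2 T'.1 = List.replicate k (e, 2) := by simp [hT', shiftWord]
  have hr : Runs (List.replicate k (e, 2)) 4 4 := hk ▸ runs_shift 2 0 T'.2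
  rw [bend_add, ← append_replicate he k hr]
  exact append_congr (.of_eq hk hr) _

theorem bend_add_integerTangle (T : TwoTangle) (a : ℤ) :
    bend (add T (integerTangle a)) = (twist 2 ^ a) • bend T := by
  obtain ⟨k, rfl | rfl⟩ := a.eq_nat_or_neg
  · rw [zpow_natCast, Equiv.Perm.smul_def, Equiv.Perm.coe_pow]
    exact bend_add_of_eq_replicate T (runs_pos le_rfl) (by simp [integerTangle])
  · rw [zpow_neg, zpow_natCast, ← inv_pow, Equiv.Perm.smul_def, Equiv.Perm.coe_pow]
    refine bend_add_of_eq_replicate T (runs_neg le_rfl) ?_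
    rw [← mirror_integerTangle]
    simp [mirror, mirrorWord, integerTangle, Piece.mirror]

theorem bend_conway_mem_twistOrbit (l : List ℤ) : bend (conway l) ∈ twistOrbit :=
  conway_induction (P := fun _ _ T => bend T ∈ twistOrbit)
    (bend_infinityTangle ▸ pairs_mem_twistOrbit) id
    (fun {_ _ T} h => bend_rotation T ▸ rotate_mem_twistOrbit h)
    (fun {_ _ T} a h => bend_add_integerTangle T a ▸
      smul_mem_twistOrbit (zpow_mem twist_two_mem_closure a) h) l

theorem unbend (T : TwoTangle) :
    WordEquiv 2 2 ([] ++ shiftWord 2 ([(birth, 0), (birth, 1)] ++ shiftWord 2 T.1) ++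
      [(death, 1), (death, 0)]) T.1 := by
  obtain ⟨w, hw⟩ := T
  have hfar₁ : WordEquiv 6 4 ((death, 1) :: shiftWord 2 w) (shiftWord 4 w ++ [(death, 1)]) :=
    .far_word death 1 1 0 hw
  have hfar₀ : WordEquiv 4 2 ((death, 0) :: w) (shiftWord 2 w ++ [(death, 0)]) := by
    rw [← shiftWord_zero w, shiftWord_shiftWord]
    exact .far_word death 0 0 0 hw
  calc
    WordEquiv 2 2 _
        ([(birth, 2), (birth, 3)] ++ (shiftWord 4 w ++ [(death, 1)] ++ [(death, 0)])) :=
      .of_eq (by simp [shiftWord, Function.comp_def, ← add_assoc])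
        (runs_append (by decide) (runs_append hfar₁.2.1 (by decide)))
    WordEquiv 2 2 _
        ([(birth, 2), (birth, 3)] ++ ((death, 1) :: shiftWord 2 w ++ [(death, 0)])) :=
      (hfar₁.symm.append_right (by decide)).append_left (by decide)
    WordEquiv 2 2 _ ([(birth, 2), (birth, 3), (death, 1)] ++ ((death, 0) :: w)) :=
      hfar₀.symm.append_left (u := [(birth, 2), (birth, 3), (death, 1)])
    WordEquiv 2 2 _ ([(birth, 2), (death, 1), (birth, 1), (death, 0)] ++ w) :=
      .append_right (.symm (.step [(birth, 2)] [(death, 0)] (.far death birth 1 0))) hw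
    WordEquiv 2 2 _ ([(birth, 1), (death, 0)] ++ w) :=
      .append_right (.step [] [(birth, 1), (death, 0)] (.zigzag₂ 1)) hw
    WordEquiv 2 2 _ w := .append_right (.step [] [] (.zigzag₂ 0)) hw

theorem fiveMoveEquiv_of_bend_eq {T T' : TwoTangle} (h : bend T = bend T') :
    FiveMoveEquiv T T' :=
  have h' := (exact h).context (u := []) (v := [(death, 1), (death, 0)]) 2 0 (k := 2) (l := 2)
    (by decide) (by decide)
  ((unbend T).symm.trans (h'.trans (unbend T'))).2.2

/-! ### Classification -/

namespace IsRational

variable {p q p' q' r s : ℤ} {T T' : TwoTangle}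

theorem exists_conway (h : IsRational p q T) :
    ∃ l, ModEqUpToSign 5 (p, q) (fraction l) ∧ FiveMoveEquiv T (conway l) := by
  obtain ⟨l, hl | hl, hT⟩ := h
  · exact ⟨l, hl ▸ .refl _, hT.fiveMoveEquiv⟩
  · exact ⟨l, hl ▸ (ModEqUpToSign.refl _).neg_left.symm, hT.fiveMoveEquiv⟩

theorem modEqUpToSign (h : IsRational p q T) (h' : IsRational p' q' T') (H : FiveMoveEquiv T T') :
    ModEqUpToSign 5 (p, q) (p', q') := by
  obtain ⟨l, hl, hT⟩ := h.exists_conway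
  obtain ⟨l', hl', hT'⟩ := h'.exists_conway
  have hll' : FiveMoveEquiv (conway l) (conway l') := (hT.symm.trans _ _ _ H).trans _ _ _ hT'
  exact (hl.trans (modEqUpToSign_of_fiveMoveEquiv_conway hll')).trans hl'.symm

theorem bend_mem_twistOrbit (h : IsRational p q T) : bend T ∈ twistOrbit := by
  obtain ⟨l, -, hT⟩ := h.exists_conway
  exact bend_congr hT ▸ bend_conway_mem_twistOrbit l

end IsRational

theorem exists_representatives :
    ∃ R : twelveFractions → TwoTangle, (∀ c, IsRational c.1.1 c.1.2 (R c)) ∧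
      ∀ {p q T}, IsRational p q T → ∃ c, FiveMoveEquiv T (R c) := by
  choose R hR using fun c : twelveFractions =>
    exists_isRational c.1.1 c.1.2 (isCoprime_of_mem_twelveFractions c.2)
  have hinj : Function.Injective fun c => bend (R c) := fun c d h =>
    Subtype.ext (eq_of_mem_twelveFractions c.2 d.2
      ((hR c).modEqUpToSign (hR d) (fiveMoveEquiv_of_bend_eq h)))
  have hrange : Set.range (fun c => bend (R c)) = twistOrbit := by
    refine (Set.finite_range _).eq_of_subset_of_encard_le
      (Set.range_subset_iff.2 fun c => (hR c).bend_mem_twistOrbit) ?_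
    rw [← Set.image_univ, hinj.encard_image, Set.encard_univ, ENat.card_eq_coe_fintype_card,
      Fintype.card_coe]
    exact encard_twistOrbit_le
  refine ⟨R, hR, fun {p q T} hT => ?_⟩
  obtain ⟨c, hc⟩ : bend T ∈ Set.range fun c => bend (R c) := hrange ▸ hT.bend_mem_twistOrbit
  exact ⟨c, fiveMoveEquiv_of_bend_eq hc.symm⟩

namespace IsRational

variable {p q p' q' r s : ℤ} {T T' : TwoTangle}

theorem fiveMoveEquiv_iff (h : IsRational p q T) (h' : IsRational p' q' T') :
    FiveMoveEquiv T T' ↔ ModEqUpToSign 5 (p, q) (p', q') := by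
  refine ⟨h.modEqUpToSign h', fun H => ?_⟩
  obtain ⟨R, hR, hequiv⟩ := exists_representatives
  obtain ⟨c, hc⟩ := hequiv h
  obtain ⟨c', hc'⟩ := hequiv h'
  obtain rfl : c = c' := Subtype.ext (eq_of_mem_twelveFractions c.2 c'.2
    (((h.modEqUpToSign (hR c) hc).symm.trans H).trans (h'.modEqUpToSign (hR c') hc')))
  exact hc.trans _ _ _ hc'.symm

theorem inClass_iff (h : IsRational p q T) (hrs : (r, s) ∈ twelveFractions) :
    InClass r s T ↔ ModEqUpToSign 5 (p, q) (r, s) := by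
  constructor
  · rintro ⟨R, hR, hTR⟩
    exact h.modEqUpToSign hR hTR
  · intro H
    obtain ⟨R, hR⟩ := exists_isRational r s (isCoprime_of_mem_twelveFractions hrs)
    exact ⟨R, hR, (h.fiveMoveEquiv_iff hR).2 H⟩

theorem inClass_iff_of_modEq_mul (h : IsRational p q T) (a : ℤ)
    (hrs : (r, s) ∈ twelveFractions) (hr : r ≡ a * s [ZMOD 5]) :
    InClass r s T ↔ (q ≡ s [ZMOD 5] ∨ q ≡ -s [ZMOD 5]) ∧ p ≡ a * q [ZMOD 5] :=
  (h.inClass_iff hrs).trans (modEqUpToSign_iff_of_modEq_mul hr)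

theorem inClass_iff_of_modEq_zero (h : IsRational p q T)
    (hrs : (r, s) ∈ twelveFractions) (hs : s ≡ 0 [ZMOD 5]) :
    InClass r s T ↔ q ≡ 0 [ZMOD 5] ∧ (p ≡ r [ZMOD 5] ∨ p ≡ -r [ZMOD 5]) :=
  (h.inClass_iff hrs).trans (modEqUpToSign_iff_of_modEq_zero hs)

theorem existsUnique_inClass (h : IsRational p q T) :
    ∃! c : ℤ × ℤ, c ∈ twelveFractions ∧ InClass c.1 c.2 T := by
  obtain ⟨R, hR, hequiv⟩ := exists_representatives
  obtain ⟨c, hc⟩ := hequiv h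
  refine ⟨c, ⟨c.2, R c, hR c, hc⟩, ?_⟩
  rintro d ⟨hd, R', hR', hT⟩
  exact eq_of_mem_twelveFractions hd c.2
    ((h.modEqUpToSign hR' hT).symm.trans (h.modEqUpToSign (hR c) hc))

end IsRational

end FiveMoves

theorem proposition2p11 :
    (∀ (p q : ℤ) (T : TwoTangle), IsRational p q T →
      (∃! c : ℤ × ℤ, c ∈ twelveFractions ∧ InClass c.1 c.2 T) ∧
      (InClass 1 0 T ↔ q ≡ 0 [ZMOD 5] ∧ (p ≡ 1 [ZMOD 5] ∨ p ≡ -1 [ZMOD 5])) ∧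
      (InClass 2 5 T ↔ q ≡ 0 [ZMOD 5] ∧ (p ≡ 2 [ZMOD 5] ∨ p ≡ -2 [ZMOD 5])) ∧
      (InClass 0 1 T ↔ (q ≡ 1 [ZMOD 5] ∨ q ≡ -1 [ZMOD 5]) ∧ p ≡ 0 [ZMOD 5]) ∧
      (InClass 5 2 T ↔ (q ≡ 2 [ZMOD 5] ∨ q ≡ -2 [ZMOD 5]) ∧ p ≡ 0 [ZMOD 5]) ∧
      (InClass (-1) 1 T ↔ (q ≡ 1 [ZMOD 5] ∨ q ≡ -1 [ZMOD 5]) ∧ p ≡ -q [ZMOD 5]) ∧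
      (InClass 3 2 T ↔ (q ≡ 2 [ZMOD 5] ∨ q ≡ -2 [ZMOD 5]) ∧ p ≡ -q [ZMOD 5]) ∧
      (InClass 1 1 T ↔ (q ≡ 1 [ZMOD 5] ∨ q ≡ -1 [ZMOD 5]) ∧ p ≡ q [ZMOD 5]) ∧
      (InClass (-3) 2 T ↔ (q ≡ 2 [ZMOD 5] ∨ q ≡ -2 [ZMOD 5]) ∧ p ≡ q [ZMOD 5]) ∧
      (InClass (-2) 1 T ↔ (q ≡ 1 [ZMOD 5] ∨ q ≡ -1 [ZMOD 5]) ∧ p ≡ -2 * q [ZMOD 5]) ∧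
      (InClass 1 2 T ↔ (q ≡ 2 [ZMOD 5] ∨ q ≡ -2 [ZMOD 5]) ∧ p ≡ -2 * q [ZMOD 5]) ∧
      (InClass 2 1 T ↔ (q ≡ 1 [ZMOD 5] ∨ q ≡ -1 [ZMOD 5]) ∧ p ≡ 2 * q [ZMOD 5]) ∧
      (InClass (-1) 2 T ↔ (q ≡ 2 [ZMOD 5] ∨ q ≡ -2 [ZMOD 5]) ∧ p ≡ 2 * q [ZMOD 5])) ∧
    (∀ (p q p' q' : ℤ) (T T' : TwoTangle), IsRational p q T → IsRational p' q' T' →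
      (FiveMoveEquiv T T' ↔
        (q ≡ q' [ZMOD 5] ∧ p ≡ p' [ZMOD 5]) ∨ (q ≡ -q' [ZMOD 5] ∧ p ≡ -p' [ZMOD 5]))) := by
  refine ⟨fun p q T h => ⟨h.existsUnique_inClass, ?_⟩,
    fun p q p' q' T T' h h' => h.fiveMoveEquiv_iff h'⟩
  have hmul (a : ℤ) {r s : ℤ} := h.inClass_iff_of_modEq_mul a (r := r) (s := s)
  refine ⟨h.inClass_iff_of_modEq_zero (by decide) (by decide),
    h.inClass_iff_of_modEq_zero (by decide) (by decide), ?_, ?_, ?_, ?_, ?_, ?_,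
    hmul (-2) (by decide) (by decide), hmul (-2) (by decide) (by decide),
    hmul 2 (by decide) (by decide), hmul 2 (by decide) (by decide)⟩
  · simpa using hmul 0 (r := 0) (s := 1) (by decide) (by decide)
  · simpa using hmul 0 (r := 5) (s := 2) (by decide) (by decide)
  · simpa using hmul (-1) (r := -1) (s := 1) (by decide) (by decide)
  · simpa using hmul (-1) (r := 3) (s := 2) (by decide) (by decide)
  · simpa using hmul 1 (r := 1) (s := 1) (by decide) (by decide)
  · simpa using hmul 1 (r := -3) (s := 2) (by decide) (by decide)
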